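/- Let $d\ge 1$ be an integer, $T>0$, $Q_T=[0,T]^d$ and $p\in[1,+\infty)$. Let $L^p(\mathbb T^d_T)$ be the space of measurable functions $u:\mathbb R^d\to\mathbb R$ with $u(x+Te_i)=u(x)$ for a.e. $x\in\mathbb R^d$ and every $i=1,\dots,d$, and $u|_{Q_T}\in L^p(Q_T)$, with norm $\|u\|=\left(\int_{Q_T}|u|^p\,dx\right)^{1/p}$. As usual, functions that are equal almost everywhere are identified, and $\rightharpoonup$ denotes weak convergence in $L^p(\mathbb T^d_T)$. Write $\langle u\rangle = T^{-d}\int_{Q_T}u\,dx$ for the average of $u$. For $s\in(0,1)$ and $u\in L^p(\mathbb T^d_T)$ put $$\mathcal F^s_p(u)=\int_{Q_T}\int_{\mathbb R^d}\frac{|u(x)-u(y)|^p}{|x-y|^{d+sp}}\,dy\,dx\in[0,+\infty],\qquad \mathcal F^0_p(u)=\int_{Q_T}\int_{Q_T}|u(x)-u(y)|^p\,dy\,dx,$$ and let $\omega_d$ be the Lebesgue measure of the unit ball of $\mathbb R^d$, so that $d\omega_d$ is the surface measure of the unit sphere $\mathbb S^{d-1}$. **Theorem** ($\Gamma$-convergence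 for $s\to0^+$). Let $(s_n)_n\subset(0,1)$ with $s_n\to0^+$ as $n\to+\infty$. 1. (Compactness.) Assume $p\ne1$, and let $(u_n)_n\subset L^p(\mathbb T^d_T)$ and $C\in\mathbb R$ satisfy $\sup_n s_n\mathcal F^{s_n}_p(u_n)\le C$. Then there are a subsequence $(u_{n_k})_k$ and a function $u\in L^p(\mathbb T^d_T)$ with $\langle u\rangle=0$ such that $u_{n_k}-\langle u_{n_k}\rangle\rightharpoonup u$ in $L^p(\mathbb T^d_T)$. 2. ($\Gamma$-liminf inequality.) For all $u\in L^p(\mathbb T^d_T)$ and all $(u_n)_n\subset L^p(\mathbb T^d_T)$ with $u_n\rightharpoonup u$ in $L^p(\mathbb T^d_T)$, $$\liminf_{n\to+\infty}s_n\mathcal F^{s_n}_p(u_n)\ge\frac{d\,\omega_d}{p\,T^d}\,\mathcal F^0_p(u).$$ 3. ($\Gamma$-limsup inequality.) For all $u\in L^p(\mathbb T^d_T)$ there is $(u_n)_n\subset L^p(\mathbb T^d_T)$ with $u_n\rightharpoonup u$ in $L^p(\mathbb T^d_T)$ and $$\limsup_{n\to+\infty}s_n\mathcal F^{s_n}_p(u_n)\le\frac{d\,\omega_d}{p\,T^d}\,\mathcal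 F^0_p(u).$$ -/

import Mathlib

open MeasureTheory Filter Topology
open scoped ENNReal

namespace PeriodicGagliardo

noncomputable section

/-- The closed periodicity cell `Q_T = [0, T]^d` in Euclidean space `ℝ^d`. -/
def cell (d : ℕ) (T : ℝ) : Set (EuclideanSpace ℝ (Fin d)) :=
  {x | ∀ i, x i ∈ Set.Icc 0 T}

theorem cell_volume_lt_top (d : ℕ) (T : ℝ) : volume (cell d T) < ∞ := by
  have h : cell d T = WithLp.toLp 2 '' (Set.univ.pi fun _ : Fin d => Set.Icc (0 : ℝ) T) := by
    ext x
    constructor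
    · intro hx
      exact ⟨WithLp.ofLp x, fun i _ => hx i, rfl⟩
    · rintro ⟨y, hy, rfl⟩ i
      exact hy i (Set.mem_univ i)
  rw [h]
  exact ((isCompact_univ_pi fun _ => isCompact_Icc).image
    (PiLp.continuous_toLp 2 _)).measure_lt_top

instance instIsFiniteMeasureCell (d : ℕ) (T : ℝ) :
    IsFiniteMeasure ((volume : Measure (EuclideanSpace ℝ (Fin d))).restrict (cell d T)) :=
  ⟨by rw [Measure.restrict_apply_univ]; exact cell_volume_lt_top d T⟩

instance instFactOneLeOfReal (p : ℝ) [h : Fact (1 ≤ p)] : Fact (1 ≤ ENNReal.ofReal p) :=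
  ⟨by rw [← ENNReal.ofReal_one]; exact ENNReal.ofReal_le_ofReal h.out⟩

/-- The (Lebesgue) measurable functions `u : ℝ^d → ℝ` which are `T`-periodic in each coordinate
direction (almost everywhere) and whose restriction to `Q_T` lies in `L^p(Q_T)`. -/
def periodicLp (d : ℕ) (T p : ℝ) : Submodule ℝ (EuclideanSpace ℝ (Fin d) → ℝ) where
  carrier := {u | AEStronglyMeasurable u volume ∧
    (∀ i : Fin d, ∀ᵐ x, u (x + T • EuclideanSpace.single i (1 : ℝ)) = u x) ∧
    MemLp u (ENNReal.ofReal p) (volume.restrict (cell d T))}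
  zero_mem' := ⟨aestronglyMeasurable_const, fun _ => Eventually.of_forall fun _ => rfl,
    MemLp.zero⟩
  add_mem' := by
    rintro u v ⟨hu, hu', hu''⟩ ⟨hv, hv', hv''⟩
    refine ⟨hu.add hv, fun i => ?_, hu''.add hv''⟩
    filter_upwards [hu' i, hv' i] with x h1 h2
    simp only [Pi.add_apply, h1, h2]
  smul_mem' := by
    rintro c u ⟨hu, hu', hu''⟩
    refine ⟨hu.const_smul c, fun i => ?_, hu''.const_smul c⟩
    filter_upwards [hu' i] with x h1
    simp only [Pi.smul_apply, h1]

/-- The space `L^p(𝕋_T^d)` of `T`-periodic `L^p` functions on `ℝ^d`. Its elements are functions, not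
almost everywhere classes: two functions are almost everywhere equal exactly when their
distance is `0`. It is a type of its own, so that it carries the norm of `L^p(Q_T)` and not the
topology of pointwise convergence. -/
def PerLp (d : ℕ) (T p : ℝ) : Type := periodicLp d T p

variable {d : ℕ} {T p : ℝ}

instance instAddCommGroupPerLp : AddCommGroup (PerLp d T p) :=
  inferInstanceAs (AddCommGroup (periodicLp d T p))

instance instModulePerLp : Module ℝ (PerLp d T p) :=
  inferInstanceAs (Module ℝ (periodicLp d T p))

instance instCoeFunPerLp : CoeFun (PerLp d T p) fun _ => EuclideanSpace ℝ (Fin d) → ℝ :=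
  ⟨fun u => u.1⟩

/-- Restriction to the periodicity cell, as a linear map `L^p(𝕋_T^d) → L^p(Q_T)`. -/
def PerLp.restrictCell (d : ℕ) (T p : ℝ) :
    PerLp d T p →ₗ[ℝ]
      Lp ℝ (ENNReal.ofReal p)
        ((volume : Measure (EuclideanSpace ℝ (Fin d))).restrict (cell d T)) where
  toFun u := MemLp.toLp u.1 u.2.2.2
  map_add' _ _ := rfl
  map_smul' _ _ := rfl

/-- The norm `‖u‖ = (∫_{Q_T} |u|^p)^{1/p}` on `L^p(𝕋_T^d)`. -/
instance instSeminormedAddCommGroupPerLp [Fact (1 ≤ p)] : SeminormedAddCommGroup (PerLp d T p) :=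
  SeminormedAddCommGroup.induced _ _ (PerLp.restrictCell d T p)

instance instNormedSpacePerLp [Fact (1 ≤ p)] : NormedSpace ℝ (PerLp d T p) :=
  NormedSpace.induced ℝ _ _ (PerLp.restrictCell d T p)

/-- Convergence of a sequence in the weak topology of `L^p(𝕋_T^d)`. -/
def WeakTendsto [Fact (1 ≤ p)] (u : ℕ → PerLp d T p) (v : PerLp d T p) : Prop :=
  Tendsto (fun n => toWeakSpace ℝ (PerLp d T p) (u n)) atTop
    (𝓝 (toWeakSpace ℝ (PerLp d T p) v))

/-- The average of `u` on the periodicity cell. -/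
def cellAverage (u : PerLp d T p) : ℝ := (1 / T ^ d) * ∫ x in cell d T, u x

/-- The function `u` minus its average on the periodicity cell. -/
def center (u : PerLp d T p) : PerLp d T p :=
  ⟨fun x => u x - cellAverage u, u.2.1.sub aestronglyMeasurable_const,
    fun i => by
      filter_upwards [u.2.2.1 i] with x hx
      rw [hx],
    u.2.2.2.sub (memLp_const (cellAverage u))⟩

/-- The energy `F_p^s(u) = ∫_{Q_T} ∫_{ℝ^d} |u(x) - u(y)|^p / |x - y|^{d + s p} dy dx`,
with values in `[0, ∞]`. -/
def energy (s : ℝ) (u : PerLp d T p) : ℝ≥0∞ :=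
  ∫⁻ x in cell d T, ∫⁻ y, ENNReal.ofReal (|u x - u y| ^ p / ‖x - y‖ ^ ((d : ℝ) + s * p))

/-- The energy `F_p^0(u) = ∬_{Q_T × Q_T} |u(x) - u(y)|^p dx dy`. -/
def energyZero (u : PerLp d T p) : ℝ≥0∞ :=
  ∫⁻ x in cell d T, ∫⁻ y in cell d T, ENNReal.ofReal (|u x - u y| ^ p)

/-- `ω_d`, the Lebesgue measure of the unit ball of `ℝ^d`; thus `d ω_d` is the surface measure of
the unit sphere. -/
def unitBallVolume (d : ℕ) : ℝ :=
  (volume (Metric.ball (0 : EuclideanSpace ℝ (Fin d)) 1)).toReal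

end

end PeriodicGagliardo

/-!
Put `e = d + s p`. For `z` in the cell, the kernels `|h| ^ (-e)` and `|h - z| ^ (-e)` agree on
`{|h| > R}` up to a factor `(1 + T √d / R) ^ (± e)`. Averaging over `z` therefore bounds
`∫_{|x - y| > R} φ(y) |x - y| ^ (-e) dy`, for a periodic `φ ≥ 0`, from both sides by the average of
`φ` times `∫_{|h| > R} |h| ^ (-e) dh = d ω_d R ^ (-s p) / (s p)`, up to that factor and a shift of
`R` by `T √d`. With `φ(y) = |u(x) - u(y)| ^ p`, letting `s → 0` and then `R → ∞`, the far part of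
`s F_p^s(u)` tends to `d ω_d / (p T ^ d) F_p^0(u)`.

* Lower bound: `F_p^0(u)` is the `p`-th power of the norm of a bounded linear image of `u`, hence
  weakly lower semicontinuous.
* Upper bound: for Lipschitz `u` the near part of `F_p^s(u)` stays bounded as `s → 0`, so it
  vanishes after multiplication by `s`; periodic Lipschitz functions are dense, and a diagonal
  argument produces the recovery sequence.
* Compactness: by Jensen's inequality `T ^ d ‖u - ⟨u⟩‖ ^ p ≤ F_p^0(u)`, and for `p > 1` bounded
  sequences of `L^p` have weakly convergent subsequences because `L^p` is the dual of `L^q`.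
-/

namespace PeriodicGagliardo

open scoped NNReal Pointwise

section LpDuality

variable {α : Type*} {m : MeasurableSpace α} {μ : Measure α}

theorem integrable_simpleFunc_mul {g : α → ℝ} (hg : Integrable g μ) (f : SimpleFunc α ℝ) :
    Integrable (fun x => f x * g x) μ := by
  obtain ⟨C, hC⟩ := f.exists_forall_norm_le
  exact hg.bdd_mul f.measurable.aestronglyMeasurable (Eventually.of_forall hC)

variable [IsFiniteMeasure μ]

theorem sum_indicatorConstLp {ι E : Type*} [NormedAddCommGroup E] {r : ℝ≥0∞} {f : ι → Set α}
    (hf : ∀ i, MeasurableSet (f i)) (hdisj : Pairwise (Function.onFun Disjoint f)) (c : E)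
    (S : Finset ι) :
    ∑ i ∈ S, indicatorConstLp r (hf i) (measure_ne_top μ (f i)) c =
      indicatorConstLp r (S.measurableSet_biUnion fun i _ => hf i)
        (measure_ne_top μ (⋃ i ∈ S, f i)) c := by
  classical
  induction S using Finset.induction_on with
  | empty => simp [indicatorConstLp_empty]
  | insert a S ha ih =>
    have hd : Disjoint (f a) (⋃ i ∈ S, f i) :=
      Set.disjoint_iUnion₂_right.2 fun i hi => hdisj fun h => ha (h ▸ hi)
    rw [Finset.sum_insert ha, ih, ← indicatorConstLp_disjoint_union (hf a)
      (S.measurableSet_biUnion fun i _ => hf i) _ _ hd]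
    congr 1
    simp

theorem hasSum_indicatorConstLp {ι E : Type*} [Countable ι] [NormedAddCommGroup E] {r : ℝ≥0∞}
    [Fact (1 ≤ r)] (hr : r ≠ ∞) {f : ι → Set α} (hf : ∀ i, MeasurableSet (f i))
    (hdisj : Pairwise (Function.onFun Disjoint f)) (c : E) :
    HasSum (fun i => indicatorConstLp r (hf i) (measure_ne_top μ (f i)) c)
      (indicatorConstLp r (MeasurableSet.iUnion hf) (measure_ne_top μ (⋃ i, f i)) c) := by
  simp only [HasSum, SummationFilter.unconditional_filter, sum_indicatorConstLp hf hdisj]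
  refine tendsto_indicatorConstLp_set hr ?_
  have hunion : Tendsto (fun S : Finset ι => μ (⋃ i ∈ S, f i)) atTop (𝓝 (μ (⋃ i, f i))) := by
    rw [Set.iUnion_eq_iUnion_finset f]
    exact tendsto_measure_iUnion_atTop fun S S' h => Set.biUnion_subset_biUnion_left h
  have hsub : ∀ S : Finset ι, ⋃ i ∈ S, f i ⊆ ⋃ i, f i := fun S =>
    Set.iUnion₂_subset fun i _ => Set.subset_iUnion f i
  simp only [fun S => symmDiff_of_le (hsub S), fun S => measure_sdiff (hsub S)
    (S.measurableSet_biUnion fun i _ => hf i).nullMeasurableSet (measure_ne_top μ _)]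
  simpa using ENNReal.Tendsto.sub (tendsto_const_nhds (x := μ (⋃ i, f i))) hunion
    (Or.inl (measure_ne_top μ _))

open scoped Classical in
/-- The signed measure `s ↦ l (1_s)` of a continuous linear functional `l` on `L^r`, `r < ∞`. Its
density with respect to `μ` represents `l`. -/
noncomputable def functionalMeasure {r : ℝ≥0∞} [Fact (1 ≤ r)] (hr : r ≠ ∞)
    (l : Lp ℝ r μ →L[ℝ] ℝ) : SignedMeasure α where
  measureOf' s :=
    if h : MeasurableSet s then l (indicatorConstLp r h (measure_ne_top μ s) 1) else 0
  empty' := by simp [indicatorConstLp_empty]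
  not_measurable' s hs := by simp [hs]
  m_iUnion' f hf hdisj := by
    simp only [hf, MeasurableSet.iUnion hf, dif_pos]
    exact (hasSum_indicatorConstLp hr hf hdisj 1).mapL l

variable {r : ℝ≥0∞} [Fact (1 ≤ r)]

theorem functionalMeasure_apply (hr : r ≠ ∞) (l : Lp ℝ r μ →L[ℝ] ℝ) {s : Set α}
    (hs : MeasurableSet s) :
    functionalMeasure hr l s = l (indicatorConstLp r hs (measure_ne_top μ s) 1) :=
  dif_pos hs

theorem functionalMeasure_absolutelyContinuous (hr : r ≠ ∞) (l : Lp ℝ r μ →L[ℝ] ℝ) :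
    functionalMeasure hr l ≪ᵥ μ.toENNRealVectorMeasure := by
  intro s h
  by_cases hs : MeasurableSet s
  · rw [Measure.toENNRealVectorMeasure_apply_measurable hs] at h
    have hzero : indicatorConstLp r hs (measure_ne_top μ s) (1 : ℝ) = 0 := by
      refine (Lp.eq_zero_iff_ae_eq_zero).2 (indicatorConstLp_coeFn.trans ?_)
      exact indicator_meas_zero h
    rw [functionalMeasure_apply hr l hs, hzero, map_zero]
  · exact (functionalMeasure hr l).not_measurable hs

theorem exists_integrable_density (hr : r ≠ ∞) (l : Lp ℝ r μ →L[ℝ] ℝ) :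
    ∃ g : α → ℝ, Measurable g ∧ Integrable g μ ∧ ∀ (s : Set α) (hs : MeasurableSet s),
      l (indicatorConstLp r hs (measure_ne_top μ s) 1) = ∫ x in s, g x ∂μ := by
  set ν := functionalMeasure hr l
  have hν : μ.withDensityᵥ (ν.rnDeriv μ) = ν :=
    (ν.absolutelyContinuous_iff_withDensityᵥ_rnDeriv_eq μ).1
      (functionalMeasure_absolutelyContinuous hr l)
  refine ⟨ν.rnDeriv μ, ν.measurable_rnDeriv μ, ν.integrable_rnDeriv μ, fun s hs => ?_⟩
  rw [← functionalMeasure_apply hr l hs, ← withDensityᵥ_apply (ν.integrable_rnDeriv μ) hs, hν]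

theorem apply_toLp_simpleFunc_eq_integral {l : Lp ℝ r μ →L[ℝ] ℝ} {g : α → ℝ} (hg : Integrable g μ)
    (hlg : ∀ (s : Set α) (hs : MeasurableSet s),
      l (indicatorConstLp r hs (measure_ne_top μ s) 1) = ∫ x in s, g x ∂μ)
    (f : SimpleFunc α ℝ) :
    l ((f.memLp_of_isFiniteMeasure r μ).toLp f) = ∫ x, f x * g x ∂μ := by
  induction f using SimpleFunc.induction with
  | @const c s hs =>
    have hsmul : ((SimpleFunc.memLp_of_isFiniteMeasure (SimpleFunc.piecewise s hs
        (SimpleFunc.const α c) (SimpleFunc.const α 0)) r μ).toLp _ : Lp ℝ r μ) =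
        c • indicatorConstLp r hs (measure_ne_top μ s) (1 : ℝ) := by
      rw [indicatorConstLp, ← MemLp.toLp_const_smul]
      congr 1
      ext x
      by_cases hx : x ∈ s <;> simp [hx]
    rw [hsmul, map_smul, hlg, smul_eq_mul, ← integral_const_mul, ← integral_indicator hs]
    congr 1
    ext x
    by_cases hx : x ∈ s <;> simp [hx]
  | @add f f' _ hf hf' =>
    have hadd : (((f + f').memLp_of_isFiniteMeasure r μ).toLp _ : Lp ℝ r μ) =
        (f.memLp_of_isFiniteMeasure r μ).toLp f + (f'.memLp_of_isFiniteMeasure r μ).toLp f' := rfl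
    rw [hadd, map_add, hf, hf',
      ← integral_add (integrable_simpleFunc_mul hg f) (integrable_simpleFunc_mul hg f')]
    simp only [SimpleFunc.coe_add, Pi.add_apply, add_mul]

theorem le_rpow_of_le_mul_rpow_inv {p q A M : ℝ} (hpq : p.HolderConjugate q) (hA : 0 ≤ A)
    (hM : 0 ≤ M) (h : A ≤ M * A ^ p⁻¹) : A ≤ M ^ q := by
  rcases hA.eq_or_lt with rfl | hA
  · positivity
  rw [← Real.rpow_inv_le_iff_of_pos hA.le hM hpq.symm.pos, ← hpq.one_sub_inv, Real.rpow_sub hA,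
    Real.rpow_one]
  exact (div_le_iff₀ (by positivity)).2 h

/-- The simple function `sign g * f^{1/p}`, which nearly attains the norm in `L^q` of `g` when `f`
is a simple function close to `|g|^q`. -/
noncomputable def signedRoot {g : α → ℝ} (hg : Measurable g) (p : ℝ) (f : SimpleFunc α ℝ≥0) :
    SimpleFunc α ℝ :=
  SimpleFunc.piecewise {x | 0 ≤ g x} (measurableSet_le measurable_const hg)
    (f.map fun t : ℝ≥0 => (t : ℝ) ^ p⁻¹) (f.map fun t : ℝ≥0 => -(t : ℝ) ^ p⁻¹)

theorem signedRoot_mul {g : α → ℝ} (hg : Measurable g) (p : ℝ) (f : SimpleFunc α ℝ≥0) (x : α) :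
    signedRoot hg p f x * g x = (f x : ℝ) ^ p⁻¹ * |g x| := by
  rcases le_or_gt 0 (g x) with hx | hx
  · simp [signedRoot, SimpleFunc.piecewise_apply, hx, abs_of_nonneg hx]
  · simp [signedRoot, SimpleFunc.piecewise_apply, hx.not_ge, abs_of_neg hx]

theorem norm_signedRoot_rpow {g : α → ℝ} (hg : Measurable g) {p : ℝ} (hp : p ≠ 0)
    (f : SimpleFunc α ℝ≥0) (x : α) : ‖signedRoot hg p f x‖ ^ p = f x := by
  have hnorm : ‖signedRoot hg p f x‖ = (f x : ℝ) ^ p⁻¹ := by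
    have := Real.rpow_nonneg (f x).coe_nonneg p⁻¹
    rcases le_or_gt 0 (g x) with hx | hx
    · simpa [signedRoot, SimpleFunc.piecewise_apply, hx] using this
    · simpa [signedRoot, SimpleFunc.piecewise_apply, hx.not_ge] using this
  rw [hnorm, Real.rpow_inv_rpow (f x).coe_nonneg hp]

variable {p q : ℝ} [Fact (1 ≤ ENNReal.ofReal p)]

theorem integral_simpleFunc_le_opNorm_rpow (hpq : p.HolderConjugate q)
    {l : Lp ℝ (ENNReal.ofReal p) μ →L[ℝ] ℝ} {g : α → ℝ} (hgm : Measurable g)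
    (hg : Integrable g μ)
    (hlg : ∀ (s : Set α) (hs : MeasurableSet s),
      l (indicatorConstLp _ hs (measure_ne_top μ s) 1) = ∫ x in s, g x ∂μ)
    (f : SimpleFunc α ℝ≥0) (hf : ∀ x, (f x : ℝ) ≤ |g x| ^ q) :
    ∫ x, (f x : ℝ) ∂μ ≤ ‖l‖ ^ q := by
  set b : SimpleFunc α ℝ := signedRoot hgm p f
  have hb := b.memLp_of_isFiniteMeasure (ENNReal.ofReal p) μ
  have hle : ∀ x, (f x : ℝ) ≤ b x * g x := fun x => by
    have hroot : (f x : ℝ) ^ q⁻¹ ≤ |g x| :=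
      (Real.rpow_inv_le_iff_of_pos (f x).coe_nonneg (abs_nonneg _) hpq.symm.pos).2 (hf x)
    calc (f x : ℝ) = (f x : ℝ) ^ p⁻¹ * (f x : ℝ) ^ q⁻¹ := by
          rw [← Real.rpow_add_of_nonneg (f x).coe_nonneg hpq.inv_nonneg hpq.symm.inv_nonneg,
            hpq.inv_add_inv_eq_one, Real.rpow_one]
      _ ≤ (f x : ℝ) ^ p⁻¹ * |g x| := by gcongr
      _ = b x * g x := (signedRoot_mul hgm p f x).symm
  have hnorm : ‖hb.toLp b‖ = (∫ x, (f x : ℝ) ∂μ) ^ p⁻¹ := by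
    rw [Lp.norm_toLp, hb.eLpNorm_eq_integral_rpow_norm (by simpa using hpq.pos)
      ENNReal.ofReal_ne_top, ENNReal.toReal_ofReal hpq.nonneg,
      ENNReal.toReal_ofReal (by positivity)]
    simp only [b, norm_signedRoot_rpow hgm hpq.ne_zero]
  have hint : Integrable (fun x => (f x : ℝ)) μ :=
    memLp_one_iff_integrable.1 ((f.map ((↑) : ℝ≥0 → ℝ)).memLp_of_isFiniteMeasure 1 μ)
  refine le_rpow_of_le_mul_rpow_inv hpq (integral_nonneg fun x => (f x).coe_nonneg)
    (norm_nonneg l) ?_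
  calc ∫ x, (f x : ℝ) ∂μ ≤ ∫ x, b x * g x ∂μ :=
        integral_mono hint (integrable_simpleFunc_mul hg b) hle
    _ = l (hb.toLp b) := (apply_toLp_simpleFunc_eq_integral hg hlg b).symm
    _ ≤ ‖l‖ * ‖hb.toLp b‖ := (le_abs_self _).trans (l.le_opNorm _)
    _ = ‖l‖ * (∫ x, (f x : ℝ) ∂μ) ^ p⁻¹ := by rw [hnorm]

theorem memLp_of_density (hpq : p.HolderConjugate q)
    {l : Lp ℝ (ENNReal.ofReal p) μ →L[ℝ] ℝ} {g : α → ℝ} (hgm : Measurable g)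
    (hg : Integrable g μ)
    (hlg : ∀ (s : Set α) (hs : MeasurableSet s),
      l (indicatorConstLp _ hs (measure_ne_top μ s) 1) = ∫ x in s, g x ∂μ) :
    MemLp g (ENNReal.ofReal q) μ := by
  have hq := hpq.symm.pos
  refine ⟨hgm.aestronglyMeasurable, ?_⟩
  rw [eLpNorm_lt_top_iff_lintegral_rpow_enorm_lt_top (by simpa using hq) ENNReal.ofReal_ne_top,
    ENNReal.toReal_ofReal hq.le, lintegral_eq_nnreal]
  refine (iSup₂_le fun f hf => ?_).trans_lt (ENNReal.ofReal_lt_top (r := ‖l‖ ^ q))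
  have hfg : ∀ x, (f x : ℝ) ≤ |g x| ^ q := fun x => by
    have := hf x
    rw [enorm_eq_nnnorm, ← ENNReal.coe_rpow_of_nonneg _ hq.le, ENNReal.coe_le_coe] at this
    exact_mod_cast this
  have hint : Integrable (fun x => (f x : ℝ)) μ :=
    memLp_one_iff_integrable.1 ((f.map ((↑) : ℝ≥0 → ℝ)).memLp_of_isFiniteMeasure 1 μ)
  calc (f.map ((↑) : ℝ≥0 → ℝ≥0∞)).lintegral μ = ∫⁻ x, ENNReal.ofReal (f x : ℝ) ∂μ := by
        rw [← SimpleFunc.lintegral_eq_lintegral]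
        simp
    _ = ENNReal.ofReal (∫ x, (f x : ℝ) ∂μ) :=
        (ofReal_integral_eq_lintegral_ofReal hint
          (Eventually.of_forall fun x => (f x).coe_nonneg)).symm
    _ ≤ ENNReal.ofReal (‖l‖ ^ q) :=
        ENNReal.ofReal_le_ofReal (integral_simpleFunc_le_opNorm_rpow hpq hgm hg hlg f hfg)

theorem exists_lp_eq_integral_mul (hpq : p.HolderConjugate q)
    (l : Lp ℝ (ENNReal.ofReal p) μ →L[ℝ] ℝ) :
    ∃ g : Lp ℝ (ENNReal.ofReal q) μ, ∀ f : Lp ℝ (ENNReal.ofReal p) μ,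
      l f = ∫ x, f x * g x ∂μ := by
  obtain ⟨g, hgm, hg, hlg⟩ := exists_integrable_density ENNReal.ofReal_ne_top l
  have hgL := memLp_of_density hpq hgm hg hlg
  have hconj : (ENNReal.ofReal p).HolderConjugate (ENNReal.ofReal q) := hpq.ennrealOfReal
  have : Fact (1 ≤ ENNReal.ofReal q) := ⟨hconj.symm.one_le⟩
  let B := ((ContinuousLinearMap.mul ℝ ℝ).lpPairing μ (ENNReal.ofReal p)
    (ENNReal.ofReal q)).flip (hgL.toLp g)
  have hB : ∀ f, B f = ∫ x, f x * hgL.toLp g x ∂μ := fun f => by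
    simp only [B, ContinuousLinearMap.flip_apply, ContinuousLinearMap.lpPairing_eq_integral,
      ContinuousLinearMap.mul_apply']
  refine ⟨hgL.toLp g, fun f => ?_⟩
  rw [← hB]
  refine congrFun ((Lp.simpleFunc.denseRange ENNReal.ofReal_ne_top).equalizer l.continuous
    B.continuous (funext fun f => ?_)) f
  have hf : (f : Lp ℝ (ENNReal.ofReal p) μ) = ((Lp.simpleFunc.toSimpleFunc f
      ).memLp_of_isFiniteMeasure (ENNReal.ofReal p) μ).toLp (Lp.simpleFunc.toSimpleFunc f) := by
    rw [← Lp.simpleFunc.toLp_eq_toLp, Lp.simpleFunc.toLp_toSimpleFunc]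
  simp only [Function.comp_apply]
  rw [hf, apply_toLp_simpleFunc_eq_integral hg hlg, hB]
  refine integral_congr_ae ?_
  filter_upwards [hgL.coeFn_toLp, ((Lp.simpleFunc.toSimpleFunc f).memLp_of_isFiniteMeasure
    (ENNReal.ofReal p) μ).coeFn_toLp] with x hx hx'
  rw [hx, hx']

theorem exists_subseq_tendsto_functional [MeasurableSpace.CountablyGenerated α] (hp : 1 < p)
    {f : ℕ → Lp ℝ (ENNReal.ofReal p) μ} {C : ℝ} (hf : ∀ n, ‖f n‖ ≤ C) :
    ∃ φ : ℕ → ℕ, StrictMono φ ∧ ∃ v : Lp ℝ (ENNReal.ofReal p) μ,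
      ∀ l : Lp ℝ (ENNReal.ofReal p) μ →L[ℝ] ℝ, Tendsto (fun k => l (f (φ k))) atTop (𝓝 (l v)) := by
  set q := p.conjExponent
  have hpq : p.HolderConjugate q := Real.HolderConjugate.conjExponent hp
  have hconj : (ENNReal.ofReal p).HolderConjugate (ENNReal.ofReal q) := hpq.ennrealOfReal
  have : Fact (1 ≤ ENNReal.ofReal q) := ⟨hconj.symm.one_le⟩
  have : Fact (ENNReal.ofReal q ≠ ∞) := ⟨ENNReal.ofReal_ne_top⟩
  -- `L^p` is the dual of the separable space `L^q`, whose dual balls are weak-* sequentially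
  -- compact.
  set B := (ContinuousLinearMap.mul ℝ ℝ).lpPairing μ (ENNReal.ofReal p) (ENNReal.ofReal q)
  have hB : ∀ f g, B f g = ∫ x, f x * g x ∂μ := fun f g => by
    simp only [B, ContinuousLinearMap.lpPairing_eq_integral, ContinuousLinearMap.mul_apply']
  have hball : ∀ n, StrongDual.toWeakDual (B (f n)) ∈ WeakDual.toStrongDual ⁻¹'
      Metric.closedBall (0 : StrongDual ℝ (Lp ℝ (ENNReal.ofReal q) μ)) (‖B‖ * C) := fun n =>
    mem_closedBall_zero_iff.2 ((B.le_opNorm _).trans (by gcongr; exact hf n))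
  obtain ⟨L, -, φ, hφ, hL⟩ :=
    WeakDual.isSeqCompact_closedBall ℝ (Lp ℝ (ENNReal.ofReal q) μ) 0 (‖B‖ * C) hball
  obtain ⟨v, hv⟩ := exists_lp_eq_integral_mul hpq.symm (WeakDual.toStrongDual L)
  refine ⟨φ, hφ, v, fun l => ?_⟩
  obtain ⟨g, hg⟩ := exists_lp_eq_integral_mul hpq l
  have hLg : L g = l v := by
    rw [hg, ← WeakDual.toStrongDual_apply, hv]
    simp only [mul_comm]
  simp only [hg (f _), ← hB, ← hLg]
  exact ((WeakDual.eval_continuous g).tendsto L).comp hL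

end LpDuality

section Periodicity

theorem setLIntegral_eq_of_ae_invariant {G α : Type*} [AddGroup G] [Countable G] [AddAction G α]
    [MeasurableSpace α] {μ : Measure α} [MeasurableConstVAdd G α] [VAddInvariantMeasure G α μ]
    {s t : Set α} (hs : IsAddFundamentalDomain G s μ) (ht : IsAddFundamentalDomain G t μ)
    {f : α → ℝ≥0∞} (hf : ∀ g : G, ∀ᵐ x ∂μ, f (g +ᵥ x) = f x) :
    ∫⁻ x in s, f x ∂μ = ∫⁻ x in t, f x ∂μ := by
  calc ∫⁻ x in s, f x ∂μ = ∑' g : G, ∫⁻ x in s ∩ (g +ᵥ t), f x ∂μ := ht.setLIntegral_eq_tsum f s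
    _ = ∑' g : G, ∫⁻ x in (g +ᵥ t) ∩ s, f (-g +ᵥ x) ∂μ := by
        refine tsum_congr fun g => ?_
        rw [Set.inter_comm]
        exact lintegral_congr_ae (ae_restrict_of_ae ((hf (-g)).mono fun x hx => hx.symm))
    _ = ∫⁻ x in t, f x ∂μ := (hs.setLIntegral_eq_tsum' f t).symm

theorem isAddFundamentalDomain_congr {G α : Type*} [AddGroup G] [Countable G] [AddAction G α]
    [MeasurableSpace α] {μ : Measure α} [MeasurableConstVAdd G α] [VAddInvariantMeasure G α μ]
    {s t : Set α} (hs : IsAddFundamentalDomain G s μ) (hst : s =ᵐ[μ] t) :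
    IsAddFundamentalDomain G t μ where
  nullMeasurableSet := hs.nullMeasurableSet.congr hst
  ae_covers := by
    have hmem : ∀ᵐ x ∂μ, ∀ g : G, g +ᵥ x ∈ s ↔ g +ᵥ x ∈ t := ae_all_iff.2 fun g =>
      (measurePreserving_vadd g μ).quasiMeasurePreserving.ae hst.mem_iff
    filter_upwards [hs.ae_covers, hmem] with x ⟨g, hg⟩ hx
    exact ⟨g, (hx g).1 hg⟩
  aedisjoint g g' hgg' := by
    have htranslate : ∀ k : G, (k +ᵥ s : Set α) =ᵐ[μ] (k +ᵥ t : Set α) := fun k => by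
      rw [← Set.preimage_vadd_neg, ← Set.preimage_vadd_neg]
      exact (measurePreserving_vadd (-k) μ).quasiMeasurePreserving.preimage_ae_eq hst
    exact (hs.aedisjoint hgg').congr (htranslate g).symm (htranslate g').symm

section AEPeriods

variable {G β : Type*} [AddCommGroup G] [MeasurableSpace G] [MeasurableAdd G] (μ : Measure G)
  [μ.IsAddLeftInvariant]

/-- The group of almost everywhere periods of a function. -/
def aePeriods (φ : G → β) : AddSubgroup G where
  carrier := {g | ∀ᵐ x ∂μ, φ (x + g) = φ x}
  zero_mem' := by simp
  add_mem' {g h} hg hh := by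
    filter_upwards [hg, (measurePreserving_add_right μ g).quasiMeasurePreserving.ae hh]
      with x hx hx'
    rw [← add_assoc, hx', hx]
  neg_mem' {g} hg := by
    filter_upwards [(measurePreserving_add_right μ (-g)).quasiMeasurePreserving.ae hg] with x hx
    rw [← hx, neg_add_cancel_right]

theorem mem_aePeriods {φ : G → β} {g : G} :
    g ∈ aePeriods μ φ ↔ ∀ᵐ x ∂μ, φ (x + g) = φ x := Iff.rfl

theorem aePeriods_le_comp {γ : Type*} (φ : G → β) (f : β → γ) :
    aePeriods μ φ ≤ aePeriods μ (f ∘ φ) := fun _ hg =>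
  ((mem_aePeriods μ).1 hg).mono fun _ hx => congrArg f hx

end AEPeriods

variable {d : ℕ} {T : ℝ}

/-- The basis `T e_1, …, T e_d` of `ℝ^d`. -/
noncomputable def latticeBasis (d : ℕ) (hT : 0 < T) :
    Module.Basis (Fin d) ℝ (EuclideanSpace ℝ (Fin d)) :=
  (EuclideanSpace.basisFun (Fin d) ℝ).toBasis.isUnitSMul fun _ => isUnit_iff_ne_zero.2 hT.ne'

theorem latticeBasis_apply (hT : 0 < T) (i : Fin d) :
    latticeBasis d hT i = T • EuclideanSpace.single i (1 : ℝ) := by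
  simp [latticeBasis, Module.Basis.isUnitSMul_apply]

theorem latticeBasis_repr (hT : 0 < T) (x : EuclideanSpace ℝ (Fin d)) (i : Fin d) :
    (latticeBasis d hT).repr x i = T⁻¹ * x i := by
  rw [latticeBasis, Module.Basis.repr_isUnitSMul, Units.smul_def]
  simp

/-- The lattice `T ℤ^d` of periods. -/
noncomputable abbrev lattice (d : ℕ) (hT : 0 < T) : AddSubgroup (EuclideanSpace ℝ (Fin d)) :=
  (Submodule.span ℤ (Set.range (latticeBasis d hT))).toAddSubgroup

instance instCountableLattice (hT : 0 < T) : Countable (lattice d hT) :=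
  inferInstanceAs (Countable (Submodule.span ℤ (Set.range (latticeBasis d hT))))

theorem lattice_le_iff (hT : 0 < T) {H : AddSubgroup (EuclideanSpace ℝ (Fin d))} :
    lattice d hT ≤ H ↔ ∀ i, T • EuclideanSpace.single i (1 : ℝ) ∈ H := by
  rw [lattice, Submodule.span_int_eq_addSubgroupClosure, AddSubgroup.closure_le,
    Set.range_subset_iff]
  simp only [latticeBasis_apply, SetLike.mem_coe]

theorem mem_fundamentalDomain_latticeBasis (hT : 0 < T) {x : EuclideanSpace ℝ (Fin d)} :
    x ∈ ZSpan.fundamentalDomain (latticeBasis d hT) ↔ ∀ i, x i ∈ Set.Ico 0 T := by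
  simp only [ZSpan.mem_fundamentalDomain, latticeBasis_repr, Set.mem_Ico, inv_mul_lt_iff₀ hT,
    mul_one, mul_nonneg_iff_of_pos_left (inv_pos.2 hT)]

theorem cell_eq_preimage (d : ℕ) (T : ℝ) :
    cell d T = (MeasurableEquiv.toLp 2 (Fin d → ℝ)).symm ⁻¹' Set.univ.pi fun _ => Set.Icc 0 T := by
  ext x
  exact ⟨fun hx i _ => hx i, fun hx i => hx i (Set.mem_univ i)⟩

theorem measurableSet_cell (d : ℕ) (T : ℝ) : MeasurableSet (cell d T) := by
  rw [cell_eq_preimage]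
  exact MeasurableEquiv.measurable _ (MeasurableSet.univ_pi fun _ => measurableSet_Icc)

theorem volume_cell (d : ℕ) {T : ℝ} (hT : 0 ≤ T) :
    volume (cell d T) = ENNReal.ofReal (T ^ d) := by
  rw [cell_eq_preimage, (EuclideanSpace.volume_preserving_symm_measurableEquiv_toLp
    (Fin d)).measure_preimage_equiv, volume_pi_pi]
  simp [ENNReal.ofReal_pow hT]

theorem volume_cell_ne_zero (hT : 0 < T) : volume (cell d T) ≠ 0 := by
  rw [volume_cell d hT.le, Ne, ENNReal.ofReal_eq_zero, not_le]
  positivity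

theorem fundamentalDomain_ae_eq_cell (hT : 0 < T) :
    (ZSpan.fundamentalDomain (latticeBasis d hT) : Set (EuclideanSpace ℝ (Fin d)))
      =ᵐ[volume] cell d T := by
  have hbox : ZSpan.fundamentalDomain (latticeBasis d hT) =
      (MeasurableEquiv.toLp 2 (Fin d → ℝ)).symm ⁻¹' Set.univ.pi fun _ => Set.Ico 0 T := by
    ext x
    rw [mem_fundamentalDomain_latticeBasis]
    exact ⟨fun hx i _ => hx i, fun hx i => hx i (Set.mem_univ i)⟩
  rw [hbox, cell_eq_preimage]
  exact (EuclideanSpace.volume_preserving_symm_measurableEquiv_toLp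
    (Fin d)).quasiMeasurePreserving.preimage_ae_eq
    (Measure.ae_eq_set_pi fun _ _ => Ico_ae_eq_Icc)

theorem norm_le_of_mem_cell (hT : 0 ≤ T) {x : EuclideanSpace ℝ (Fin d)} (hx : x ∈ cell d T) :
    ‖x‖ ≤ T * √d := by
  have hcoord : ∀ i, ‖x i‖ ≤ T := fun i => by
    rw [Real.norm_of_nonneg (hx i).1]
    exact (hx i).2
  calc ‖x‖ ≤ √(∑ _i : Fin d, T ^ 2) := by
        rw [EuclideanSpace.norm_eq]
        gcongr with i
        exact hcoord i
    _ = T * √d := by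
        rw [Finset.sum_const, Finset.card_univ, Fintype.card_fin, nsmul_eq_mul, mul_comm,
          Real.sqrt_mul (by positivity), Real.sqrt_sq hT]

variable {φ : EuclideanSpace ℝ (Fin d) → ℝ≥0∞}

theorem isAddFundamentalDomain_cell (hT : 0 < T) :
    IsAddFundamentalDomain (lattice d hT) (cell d T) volume :=
  isAddFundamentalDomain_congr (ZSpan.isAddFundamentalDomain' (latticeBasis d hT) volume)
    (fundamentalDomain_ae_eq_cell hT)

theorem setLIntegral_cell_add_left (hT : 0 < T) (hφ : lattice d hT ≤ aePeriods volume φ)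
    (h : EuclideanSpace ℝ (Fin d)) :
    ∫⁻ z in cell d T, φ (h + z) = ∫⁻ y in cell d T, φ y := by
  have hD := isAddFundamentalDomain_cell (d := d) hT
  have htranslate : ∫⁻ z in cell d T, φ (h + z) = ∫⁻ y in (h +ᵥ cell d T), φ y :=
    (measurePreserving_add_left volume h).setLIntegral_comp_emb
      (measurableEmbedding_addLeft h) φ _
  rw [htranslate]
  refine setLIntegral_eq_of_ae_invariant (hD.vadd_of_comm h) hD fun g => ?_
  filter_upwards [hφ g.2] with x hx
  rw [AddSubgroup.vadd_def, vadd_eq_add, add_comm, hx]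

theorem setLIntegral_cell_lintegral_mul_sub (hT : 0 < T) (hφm : AEMeasurable φ)
    (hφ : lattice d hT ≤ aePeriods volume φ) {G : EuclideanSpace ℝ (Fin d) → ℝ≥0∞}
    (hG : Measurable G) :
    ∫⁻ z in cell d T, ∫⁻ y, φ y * G (y - z) = (∫⁻ y in cell d T, φ y) * ∫⁻ w, G w := by
  have hmeas : AEMeasurable (fun z : EuclideanSpace ℝ (Fin d) × EuclideanSpace ℝ (Fin d) =>
      φ (z.2 + z.1) * G z.2) ((volume.restrict (cell d T)).prod volume) := by
    refine (hφm.comp_quasiMeasurePreserving ?_).mul (hG.comp measurable_snd).aemeasurable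
    exact (quasiMeasurePreserving_add_swap volume volume).mono_left
      (Measure.restrict_le_self.absolutelyContinuous.prod .rfl)
  calc ∫⁻ z in cell d T, ∫⁻ y, φ y * G (y - z)
      = ∫⁻ z in cell d T, ∫⁻ h, φ (h + z) * G h := by
        refine lintegral_congr fun z => ?_
        rw [← lintegral_add_right_eq_self _ z]
        simp only [add_sub_cancel_right]
    _ = ∫⁻ h, ∫⁻ z in cell d T, φ (h + z) * G h := lintegral_lintegral_swap hmeas
    _ = ∫⁻ h, (∫⁻ y in cell d T, φ y) * G h := by
        refine lintegral_congr fun h => ?_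
        rw [lintegral_mul_const'' _ ?_, setLIntegral_cell_add_left hT hφ]
        exact (hφm.comp_quasiMeasurePreserving
          (measurePreserving_add_left volume h).quasiMeasurePreserving).restrict
    _ = (∫⁻ y in cell d T, φ y) * ∫⁻ w, G w := lintegral_const_mul _ hG

end Periodicity

section Radial

/-- The radial kernel `‖h‖ ^ (-e)` restricted to the vectors whose norm lies in `I`. -/
noncomputable def radialKernel {E : Type*} [Norm E] (I : Set ℝ) (e : ℝ) (h : E) : ℝ≥0∞ :=
  I.indicator (fun r => ENNReal.ofReal (r ^ (-e))) ‖h‖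

section Norm

variable {E : Type*} [Norm E] {I : Set ℝ} {e : ℝ} {h : E}

theorem radialKernel_of_mem (hh : ‖h‖ ∈ I) :
    radialKernel I e h = ENNReal.ofReal (‖h‖ ^ (-e)) :=
  Set.indicator_of_mem hh _

theorem radialKernel_of_notMem (hh : ‖h‖ ∉ I) : radialKernel I e h = 0 :=
  Set.indicator_of_notMem hh _

theorem ofReal_norm_rpow_mul_radialKernel (hI : I ⊆ Set.Ioi 0) (q : ℝ) :
    ENNReal.ofReal (‖h‖ ^ q) * radialKernel I e h = radialKernel I (e - q) h := by
  by_cases hh : ‖h‖ ∈ I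
  · have hpos : 0 < ‖h‖ := hI hh
    rw [radialKernel_of_mem hh, radialKernel_of_mem hh, ← ENNReal.ofReal_mul (by positivity),
      ← Real.rpow_add hpos, neg_sub, sub_eq_add_neg]
  · rw [radialKernel_of_notMem hh, radialKernel_of_notMem hh, mul_zero]

theorem radialKernel_Ioc_add_Ioi {a R : ℝ} (haR : a ≤ R) :
    radialKernel (Set.Ioc a R) e h + radialKernel (Set.Ioi R) e h =
      radialKernel (Set.Ioi a) e h := by
  rw [radialKernel, radialKernel, radialKernel, ← Set.Ioc_union_Ioi_eq_Ioi haR,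
    Set.indicator_union_of_disjoint (Set.Ioc_disjoint_Ioi le_rfl)]

end Norm

theorem measurable_radialKernel {E : Type*} [SeminormedAddCommGroup E] [MeasurableSpace E]
    [OpensMeasurableSpace E] {I : Set ℝ} (hI : MeasurableSet I) (e : ℝ) :
    Measurable (radialKernel I e : E → ℝ≥0∞) :=
  ((measurable_id.pow_const (-e)).ennreal_ofReal.indicator hI).comp
    continuous_norm.measurable

theorem radialKernel_Ioi_add_le {E : Type*} [SeminormedAddCommGroup E] {a b : E} {D R e : ℝ}
    (hab : ‖a - b‖ ≤ D) (hR : 0 < R) (he : 0 ≤ e) :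
    radialKernel (Set.Ioi (R + D)) e a ≤
      ENNReal.ofReal ((1 + D / R) ^ e) * radialKernel (Set.Ioi R) e b := by
  by_cases ha : ‖a‖ ∈ Set.Ioi (R + D)
  · have hD : 0 ≤ D := (norm_nonneg _).trans hab
    have hRD : R + D < ‖a‖ := ha
    have hb : R < ‖b‖ := by linarith [norm_sub_norm_le a b]
    have hba : ‖b‖ ≤ (1 + D / R) * ‖a‖ := by
      have hDa : D ≤ D / R * ‖a‖ := by
        rw [div_mul_eq_mul_div, le_div_iff₀ hR]
        exact mul_le_mul_of_nonneg_left (by linarith) hD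
      linarith [norm_sub_norm_le b a, norm_sub_rev a b]
    have ha0 : 0 < ‖a‖ := by linarith
    have hb0 : 0 < ‖b‖ := hR.trans hb
    rw [radialKernel_of_mem ha, radialKernel_of_mem (I := Set.Ioi R) hb,
      ← ENNReal.ofReal_mul (by positivity)]
    refine ENNReal.ofReal_le_ofReal ?_
    calc ‖a‖ ^ (-e) = (1 + D / R) ^ e * ((1 + D / R) * ‖a‖) ^ (-e) := by
          rw [Real.mul_rpow (by positivity) ha0.le, ← mul_assoc, ← Real.rpow_add (by positivity),
            add_neg_cancel, Real.rpow_zero, one_mul]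
      _ ≤ (1 + D / R) ^ e * ‖b‖ ^ (-e) := by
          gcongr _ * ?_
          exact Real.rpow_le_rpow_of_nonpos hb0 hba (neg_nonpos.2 he)
  · rw [radialKernel_of_notMem ha]
    exact zero_le

variable {E : Type*} [NormedAddCommGroup E] [NormedSpace ℝ E] [FiniteDimensional ℝ E]
  [Nontrivial E] [MeasurableSpace E] [BorelSpace E] (μ : Measure E) [μ.IsAddHaarMeasure]

theorem lintegral_radialKernel {I : Set ℝ} (hI : MeasurableSet I) (hI0 : I ⊆ Set.Ioi 0) {c : ℝ}
    (hc : IntegrableOn (fun r => r ^ (c - 1)) I) :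
    ∫⁻ h, radialKernel I (Module.finrank ℝ E - c) h ∂μ =
      ENNReal.ofReal
        (Module.finrank ℝ E * μ.real (Metric.ball 0 1) * ∫ r in I, r ^ (c - 1)) := by
  set n := Module.finrank ℝ E
  set f : ℝ → ℝ := I.indicator fun r => r ^ (c - n)
  have hkernel : ∀ h : E, radialKernel I (n - c) h = ENNReal.ofReal (f ‖h‖) := fun h => by
    by_cases hh : ‖h‖ ∈ I
    · simp only [f, radialKernel_of_mem hh, Set.indicator_of_mem hh, neg_sub]
    · simp only [f, radialKernel_of_notMem hh, Set.indicator_of_notMem hh, ENNReal.ofReal_zero]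
  have hf_nonneg : ∀ r, 0 ≤ f r :=
    Set.indicator_nonneg fun r hr => Real.rpow_nonneg (le_of_lt (hI0 hr)) _
  have hpolar : Set.EqOn (fun r => r ^ (n - 1) • f r) (I.indicator fun r => r ^ (c - 1))
      (Set.Ioi 0) := fun r hr => by
    by_cases hrI : r ∈ I
    · have hn : 1 ≤ n := Module.finrank_pos
      simp only [f, Set.indicator_of_mem hrI, smul_eq_mul]
      rw [← Real.rpow_natCast, ← Real.rpow_add hr, Nat.cast_sub hn, Nat.cast_one]
      ring_nf
    · simp only [f, Set.indicator_of_notMem hrI, smul_zero]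
  have hint : Integrable (fun h : E => f ‖h‖) μ := by
    rw [integrable_fun_norm_addHaar]
    exact ((integrable_indicator_iff hI).2 hc).integrableOn.congr_fun hpolar.symm measurableSet_Ioi
  simp only [hkernel]
  rw [← ofReal_integral_eq_lintegral_ofReal hint (Eventually.of_forall fun h => hf_nonneg _),
    integral_fun_norm_addHaar, setIntegral_congr_fun measurableSet_Ioi hpolar,
    setIntegral_indicator hI, Set.inter_eq_right.2 hI0, nsmul_eq_mul, smul_eq_mul, mul_assoc]

theorem lintegral_radialKernel_Ioi {R a : ℝ} (hR : 0 < R) (ha : 0 < a) :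
    ∫⁻ h, radialKernel (Set.Ioi R) (Module.finrank ℝ E + a) h ∂μ =
      ENNReal.ofReal (Module.finrank ℝ E * μ.real (Metric.ball 0 1) * (R ^ (-a) / a)) := by
  have hlt : -a - 1 < -1 := by linarith
  have h := lintegral_radialKernel μ measurableSet_Ioi (Set.Ioi_subset_Ioi hR.le)
    (integrableOn_Ioi_rpow_of_lt hlt hR)
  rwa [integral_Ioi_rpow_of_lt hlt hR, sub_add_cancel, neg_div_neg_eq, sub_neg_eq_add] at h

theorem lintegral_radialKernel_Ioc {R b : ℝ} (hR : 0 ≤ R) (hb : 0 < b) :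
    ∫⁻ h, radialKernel (Set.Ioc 0 R) (Module.finrank ℝ E - b) h ∂μ =
      ENNReal.ofReal (Module.finrank ℝ E * μ.real (Metric.ball 0 1) * (R ^ b / b)) := by
  have hlt : -1 < b - 1 := by linarith
  rw [lintegral_radialKernel μ measurableSet_Ioc Set.Ioc_subset_Ioi_self
      ((intervalIntegrable_iff_integrableOn_Ioc_of_le hR).1
        (intervalIntegral.intervalIntegrable_rpow' hlt)),
    ← intervalIntegral.integral_of_le hR, integral_rpow (Or.inl hlt), sub_add_cancel,
    Real.zero_rpow hb.ne', sub_zero]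

end Radial

section EnergyBounds

variable {d : ℕ} {T p : ℝ}

theorem finrank_mul_ball_eq (d : ℕ) :
    (Module.finrank ℝ (EuclideanSpace ℝ (Fin d)) : ℝ) *
      volume.real (Metric.ball (0 : EuclideanSpace ℝ (Fin d)) 1) = d * unitBallVolume d := by
  rw [finrank_euclideanSpace_fin]
  rfl

theorem unitBallVolume_pos (d : ℕ) : 0 < unitBallVolume d :=
  ENNReal.toReal_pos (Metric.measure_ball_pos volume _ zero_lt_one).ne' measure_ball_lt_top.ne

section Cell

variable {φ : EuclideanSpace ℝ (Fin d) → ℝ≥0∞} {R e : ℝ}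

theorem lintegral_cell_lintegral_mul_radialKernel (hT : 0 < T) (hφm : AEMeasurable φ)
    (hφ : lattice d hT ≤ aePeriods volume φ) (x : EuclideanSpace ℝ (Fin d)) :
    ∫⁻ z in cell d T, ∫⁻ y, φ y * radialKernel (Set.Ioi R) e (x - (y - z)) =
      (∫⁻ y in cell d T, φ y) *
        ∫⁻ h : EuclideanSpace ℝ (Fin d), radialKernel (Set.Ioi R) e h := by
  rw [setLIntegral_cell_lintegral_mul_sub hT hφm hφ
    (G := fun w => radialKernel (Set.Ioi R) e (x - w))
    ((measurable_radialKernel measurableSet_Ioi e).comp (measurable_id.const_sub x))]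
  congr 1
  exact lintegral_sub_left_eq_self (radialKernel (Set.Ioi R) e) x

theorem volume_cell_mul_lintegral_mul_radialKernel_le (hT : 0 < T) (hφm : AEMeasurable φ)
    (hφ : lattice d hT ≤ aePeriods volume φ) (hR : 0 < R) (he : 0 ≤ e)
    (x : EuclideanSpace ℝ (Fin d)) :
    volume (cell d T) * ∫⁻ y, φ y * radialKernel (Set.Ioi (R + T * √d)) e (x - y) ≤
      ENNReal.ofReal ((1 + T * √d / R) ^ e) * ((∫⁻ y in cell d T, φ y) *
        ∫⁻ h : EuclideanSpace ℝ (Fin d), radialKernel (Set.Ioi R) e h) := by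
  rw [← lintegral_cell_lintegral_mul_radialKernel hT hφm hφ x, mul_comm, ← setLIntegral_const,
    ← lintegral_const_mul' _ _ ENNReal.ofReal_ne_top]
  refine setLIntegral_mono' (measurableSet_cell d T) fun z hz => ?_
  rw [← lintegral_const_mul' _ _ ENNReal.ofReal_ne_top]
  refine lintegral_mono fun y => ?_
  rw [mul_left_comm]
  gcongr
  refine radialKernel_Ioi_add_le ?_ hR he
  rw [sub_sub_sub_cancel_left, sub_sub_cancel_left, norm_neg]
  exact norm_le_of_mem_cell hT.le hz

theorem setLIntegral_cell_mul_lintegral_radialKernel_le (hT : 0 < T) (hφm : AEMeasurable φ)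
    (hφ : lattice d hT ≤ aePeriods volume φ) (hR : 0 < R) (he : 0 ≤ e)
    (x : EuclideanSpace ℝ (Fin d)) :
    (∫⁻ y in cell d T, φ y) *
        ∫⁻ h : EuclideanSpace ℝ (Fin d), radialKernel (Set.Ioi (R + T * √d)) e h ≤
      ENNReal.ofReal ((1 + T * √d / R) ^ e) *
        (volume (cell d T) * ∫⁻ y, φ y * radialKernel (Set.Ioi R) e (x - y)) := by
  rw [← lintegral_cell_lintegral_mul_radialKernel hT hφm hφ x, mul_comm (volume _),
    ← setLIntegral_const, ← lintegral_const_mul' _ _ ENNReal.ofReal_ne_top]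
  refine setLIntegral_mono' (measurableSet_cell d T) fun z hz => ?_
  rw [← lintegral_const_mul' _ _ ENNReal.ofReal_ne_top]
  refine lintegral_mono fun y => ?_
  rw [mul_left_comm]
  gcongr
  refine radialKernel_Ioi_add_le ?_ hR he
  rw [sub_sub_sub_cancel_left, sub_sub_cancel]
  exact norm_le_of_mem_cell hT.le hz

end Cell

/-- The part of the energy `F_p^s(u)` coming from the pairs of points whose distance lies in
`I`. -/
noncomputable def truncatedEnergy (I : Set ℝ) (s : ℝ) (u : PerLp d T p) : ℝ≥0∞ :=
  ∫⁻ x in cell d T, ∫⁻ y, ENNReal.ofReal (|u x - u y| ^ p) * radialKernel I (d + s * p) (x - y)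

theorem energy_eq_truncatedEnergy (hp : 0 < p) (s : ℝ) (u : PerLp d T p) :
    energy s u = truncatedEnergy (Set.Ioi 0) s u := by
  refine lintegral_congr fun x => lintegral_congr fun y => ?_
  rcases eq_or_ne x y with rfl | hxy
  · simp [Real.zero_rpow hp.ne']
  · have hpos : ‖x - y‖ ∈ Set.Ioi 0 := norm_pos_iff.2 (sub_ne_zero.2 hxy)
    rw [radialKernel_of_mem hpos, ← ENNReal.ofReal_mul (by positivity),
      Real.rpow_neg (norm_nonneg _), div_eq_mul_inv]

theorem truncatedEnergy_Ioc_add_Ioi {s R : ℝ} (hR : 0 ≤ R) (u : PerLp d T p) :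
    truncatedEnergy (Set.Ioc 0 R) s u + truncatedEnergy (Set.Ioi R) s u =
      truncatedEnergy (Set.Ioi 0) s u := by
  have hu := u.2.1.aemeasurable
  have hmeas : AEMeasurable
      (fun z : EuclideanSpace ℝ (Fin d) × EuclideanSpace ℝ (Fin d) =>
        ENNReal.ofReal (|u z.1 - u z.2| ^ p) *
          radialKernel (Set.Ioc 0 R) (d + s * p) (z.1 - z.2))
      ((volume.restrict (cell d T)).prod volume) := by
    have hfst : AEMeasurable (fun z : EuclideanSpace ℝ (Fin d) × EuclideanSpace ℝ (Fin d) => u z.1)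
        ((volume.restrict (cell d T)).prod volume) := hu.restrict.comp_fst
    have hsnd : AEMeasurable (fun z : EuclideanSpace ℝ (Fin d) × EuclideanSpace ℝ (Fin d) => u z.2)
        ((volume.restrict (cell d T)).prod volume) := hu.comp_snd
    exact ((hfst.sub hsnd).abs.pow_const p).ennreal_ofReal.mul
      ((measurable_radialKernel measurableSet_Ioc _).comp
        (measurable_fst.sub measurable_snd)).aemeasurable
  rw [truncatedEnergy, truncatedEnergy, ← lintegral_add_left' hmeas.lintegral_prod_right']
  refine lintegral_congr fun x => ?_
  rw [← lintegral_add_left']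
  · simp only [← mul_add, radialKernel_Ioc_add_Ioi hR]
  · exact (((hu.const_sub (u x)).abs.pow_const p).ennreal_ofReal).mul
      ((measurable_radialKernel measurableSet_Ioc _).comp
        (measurable_id.const_sub x)).aemeasurable

theorem aemeasurable_ofReal_abs_sub_rpow (u : PerLp d T p) (c : ℝ) :
    AEMeasurable fun y => ENNReal.ofReal (|c - u y| ^ p) :=
  ((u.2.1.aemeasurable.const_sub c).abs.pow_const p).ennreal_ofReal

theorem lattice_le_aePeriods (hT : 0 < T) (u : PerLp d T p) :
    lattice d hT ≤ aePeriods volume u :=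
  (lattice_le_iff hT).2 u.2.2.1

theorem lattice_le_aePeriods_abs_sub (hT : 0 < T) (u : PerLp d T p) (c : ℝ) :
    lattice d hT ≤ aePeriods volume fun y => ENNReal.ofReal (|c - u y| ^ p) :=
  (lattice_le_aePeriods hT u).trans
    (aePeriods_le_comp volume u fun t => ENNReal.ofReal (|c - t| ^ p))

/-- The mass `d ω_d R ^ (-sp) / (sp)` of the kernel `‖h‖ ^ (-(d + sp))` outside the ball of radius
`R`, multiplied by `s` and divided by the volume of the cell. -/
noncomputable def tailMass (d : ℕ) (T p R s : ℝ) : ℝ :=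
  d * unitBallVolume d * R ^ (-(s * p)) / (p * T ^ d)

theorem ofReal_mul_lintegral_radialKernel_Ioi [NeZero d] (hT : 0 < T) (hp : 0 < p) {R s : ℝ}
    (hR : 0 < R) (hs : 0 < s) :
    ENNReal.ofReal s * ∫⁻ h : EuclideanSpace ℝ (Fin d), radialKernel (Set.Ioi R) (d + s * p) h =
      volume (cell d T) * ENNReal.ofReal (tailMass d T p R s) := by
  have hmass := lintegral_radialKernel_Ioi (volume : Measure (EuclideanSpace ℝ (Fin d))) hR
    (mul_pos hs hp)
  rw [finrank_mul_ball_eq, finrank_euclideanSpace_fin] at hmass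
  rw [hmass, volume_cell d hT.le, ← ENNReal.ofReal_mul hs.le, ← ENNReal.ofReal_mul (by positivity),
    tailMass]
  congr 1
  field_simp

section FarField

variable [NeZero d] {φ : EuclideanSpace ℝ (Fin d) → ℝ≥0∞} {R s : ℝ}

theorem ofReal_mul_lintegral_mul_radialKernel_le (hT : 0 < T) (hφm : AEMeasurable φ)
    (hφ : lattice d hT ≤ aePeriods volume φ) (hp : 0 < p) (hR : 0 < R) (hs : 0 < s)
    (x : EuclideanSpace ℝ (Fin d)) :
    ENNReal.ofReal s * ∫⁻ y, φ y * radialKernel (Set.Ioi (R + T * √d)) (d + s * p) (x - y) ≤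
      ENNReal.ofReal ((1 + T * √d / R) ^ (d + s * p) * tailMass d T p R s) *
        ∫⁻ y in cell d T, φ y := by
  rw [← ENNReal.mul_le_mul_iff_right (volume_cell_ne_zero (d := d) hT) (cell_volume_lt_top d T).ne,
    ENNReal.ofReal_mul (by positivity)]
  set I := ∫⁻ y, φ y * radialKernel (Set.Ioi (R + T * √d)) (d + s * p) (x - y)
  set Φ := ∫⁻ y in cell d T, φ y
  set Λ := (1 + T * √d / R) ^ (d + s * p)
  set M := ∫⁻ h : EuclideanSpace ℝ (Fin d), radialKernel (Set.Ioi R) (d + s * p) h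
  calc volume (cell d T) * (ENNReal.ofReal s * I)
      = ENNReal.ofReal s * (volume (cell d T) * I) := mul_left_comm _ _ _
    _ ≤ ENNReal.ofReal s * (ENNReal.ofReal Λ * (Φ * M)) := by
        gcongr ENNReal.ofReal s * ?_
        exact volume_cell_mul_lintegral_mul_radialKernel_le hT hφm hφ hR (by positivity) x
    _ = ENNReal.ofReal Λ * (ENNReal.ofReal s * M) * Φ := by ring
    _ = volume (cell d T) * (ENNReal.ofReal Λ * ENNReal.ofReal (tailMass d T p R s) * Φ) := by
        rw [ofReal_mul_lintegral_radialKernel_Ioi hT hp hR hs]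
        ring

theorem ofReal_mul_setLIntegral_cell_le (hT : 0 < T) (hφm : AEMeasurable φ)
    (hφ : lattice d hT ≤ aePeriods volume φ) (hp : 0 < p) (hR : 0 < R) (hs : 0 < s)
    (x : EuclideanSpace ℝ (Fin d)) :
    ENNReal.ofReal ((1 + T * √d / R) ^ (-(d + s * p)) * tailMass d T p (R + T * √d) s) *
        ∫⁻ y in cell d T, φ y ≤
      ENNReal.ofReal s * ∫⁻ y, φ y * radialKernel (Set.Ioi R) (d + s * p) (x - y) := by
  rw [← ENNReal.mul_le_mul_iff_right (volume_cell_ne_zero (d := d) hT) (cell_volume_lt_top d T).ne,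
    ENNReal.ofReal_mul (by positivity)]
  set I := ∫⁻ y, φ y * radialKernel (Set.Ioi R) (d + s * p) (x - y)
  set Φ := ∫⁻ y in cell d T, φ y
  set Λ := (1 + T * √d / R) ^ (d + s * p) with hΛ
  have hΛ_inv : ENNReal.ofReal ((1 + T * √d / R) ^ (-(d + s * p))) * ENNReal.ofReal Λ = 1 := by
    rw [← ENNReal.ofReal_mul (by positivity), hΛ, ← Real.rpow_add (by positivity), neg_add_cancel,
      Real.rpow_zero, ENNReal.ofReal_one]
  set M := ∫⁻ h : EuclideanSpace ℝ (Fin d), radialKernel (Set.Ioi (R + T * √d)) (d + s * p) h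
  calc volume (cell d T) * (ENNReal.ofReal ((1 + T * √d / R) ^ (-(d + s * p))) *
        ENNReal.ofReal (tailMass d T p (R + T * √d) s) * Φ)
      = ENNReal.ofReal ((1 + T * √d / R) ^ (-(d + s * p))) * ENNReal.ofReal s * (Φ * M) := by
        have hM : ENNReal.ofReal s * M =
            volume (cell d T) * ENNReal.ofReal (tailMass d T p (R + T * √d) s) :=
          ofReal_mul_lintegral_radialKernel_Ioi hT hp (by positivity) hs
        rw [mul_assoc _ (ENNReal.ofReal s), mul_left_comm _ Φ, hM]
        ring
    _ ≤ ENNReal.ofReal ((1 + T * √d / R) ^ (-(d + s * p))) * ENNReal.ofReal s *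
          (ENNReal.ofReal Λ * (volume (cell d T) * I)) := by
        gcongr _ * ?_
        exact setLIntegral_cell_mul_lintegral_radialKernel_le hT hφm hφ hR (by positivity) x
    _ = ENNReal.ofReal ((1 + T * √d / R) ^ (-(d + s * p))) * ENNReal.ofReal Λ *
          (volume (cell d T) * (ENNReal.ofReal s * I)) := by ring
    _ = volume (cell d T) * (ENNReal.ofReal s * I) := by rw [hΛ_inv, one_mul]

theorem ofReal_mul_truncatedEnergy_Ioi_le (hT : 0 < T) (hp : 0 < p) (hR : 0 < R) (hs : 0 < s)
    (u : PerLp d T p) :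
    ENNReal.ofReal s * truncatedEnergy (Set.Ioi (R + T * √d)) s u ≤
      ENNReal.ofReal ((1 + T * √d / R) ^ (d + s * p) * tailMass d T p R s) * energyZero u := by
  rw [truncatedEnergy, energyZero, ← lintegral_const_mul' _ _ ENNReal.ofReal_ne_top,
    ← lintegral_const_mul' _ _ ENNReal.ofReal_ne_top]
  exact lintegral_mono fun x => ofReal_mul_lintegral_mul_radialKernel_le hT
    (aemeasurable_ofReal_abs_sub_rpow u (u x)) (lattice_le_aePeriods_abs_sub hT u (u x)) hp hR hs x

theorem ofReal_mul_energyZero_le (hT : 0 < T) (hp : 0 < p) (hR : 0 < R) (hs : 0 < s)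
    (u : PerLp d T p) :
    ENNReal.ofReal ((1 + T * √d / R) ^ (-(d + s * p)) * tailMass d T p (R + T * √d) s) *
        energyZero u ≤ ENNReal.ofReal s * energy s u := by
  calc _ ≤ ENNReal.ofReal s * truncatedEnergy (Set.Ioi R) s u := by
        rw [truncatedEnergy, energyZero, ← lintegral_const_mul' _ _ ENNReal.ofReal_ne_top,
          ← lintegral_const_mul' _ _ ENNReal.ofReal_ne_top]
        exact lintegral_mono fun x => ofReal_mul_setLIntegral_cell_le hT
          (aemeasurable_ofReal_abs_sub_rpow u (u x)) (lattice_le_aePeriods_abs_sub hT u (u x))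
          hp hR hs x
    _ ≤ ENNReal.ofReal s * energy s u := by
        rw [energy_eq_truncatedEnergy hp, ← truncatedEnergy_Ioc_add_Ioi hR.le u]
        gcongr
        exact le_add_self

end FarField

section Lipschitz

variable [NeZero d] {R s : ℝ} {K : ℝ≥0}

theorem truncatedEnergy_Ioc_le_of_lipschitzWith (hT : 0 ≤ T) (hp : 0 < p) (hR : 0 ≤ R)
    (hs : s < 1) (u : PerLp d T p) (hu : LipschitzWith K u) :
    truncatedEnergy (Set.Ioc 0 R) s u ≤ ENNReal.ofReal (K ^ p * (d * unitBallVolume d *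
      (R ^ (p * (1 - s)) / (p * (1 - s)))) * T ^ d) := by
  have hb : 0 < p * (1 - s) := mul_pos hp (by linarith)
  have hω := (unitBallVolume_pos d).le
  have hpoint : ∀ x y, ENNReal.ofReal (|u x - u y| ^ p) *
      radialKernel (Set.Ioc 0 R) (d + s * p) (x - y) ≤
      ENNReal.ofReal (K ^ p) * radialKernel (Set.Ioc 0 R) (d - p * (1 - s)) (x - y) :=
    fun x y => calc
      _ ≤ ENNReal.ofReal (K ^ p) * ENNReal.ofReal (‖x - y‖ ^ p) *
            radialKernel (Set.Ioc 0 R) (d + s * p) (x - y) := by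
          rw [← ENNReal.ofReal_mul (by positivity), ← Real.mul_rpow (by positivity) (norm_nonneg _)]
          gcongr
          exact hu.norm_sub_le x y
      _ = _ := by
          rw [mul_assoc, ofReal_norm_rpow_mul_radialKernel Set.Ioc_subset_Ioi_self]
          ring_nf
  calc truncatedEnergy (Set.Ioc 0 R) s u
      ≤ ∫⁻ x in cell d T, ∫⁻ y, ENNReal.ofReal (K ^ p) *
          radialKernel (Set.Ioc 0 R) (d - p * (1 - s)) (x - y) :=
        lintegral_mono fun x => lintegral_mono fun y => hpoint x y
    _ = ∫⁻ _x in cell d T, ENNReal.ofReal (K ^ p) * ENNReal.ofReal (d * unitBallVolume d *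
          (R ^ (p * (1 - s)) / (p * (1 - s)))) := by
        refine lintegral_congr fun x => ?_
        rw [lintegral_const_mul' _ _ ENNReal.ofReal_ne_top, lintegral_sub_left_eq_self
          (radialKernel (Set.Ioc 0 R) (d - p * (1 - s)) : EuclideanSpace ℝ (Fin d) → ℝ≥0∞),
          ← finrank_mul_ball_eq, ← lintegral_radialKernel_Ioc volume hR hb,
          finrank_euclideanSpace_fin]
    _ = _ := by
        rw [setLIntegral_const, volume_cell d hT, ← ENNReal.ofReal_mul (by positivity),
          ← ENNReal.ofReal_mul (by positivity)]

theorem ofReal_mul_energy_le_of_lipschitzWith (hT : 0 < T) (hp : 0 < p) (hR : 0 < R)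
    (hs : s ∈ Set.Ioo (0 : ℝ) 1) (u : PerLp d T p) (hu : LipschitzWith K u) :
    ENNReal.ofReal s * energy s u ≤
      ENNReal.ofReal (s * (K ^ p * (d * unitBallVolume d *
        ((R + T * √d) ^ (p * (1 - s)) / (p * (1 - s)))) * T ^ d)) +
      ENNReal.ofReal ((1 + T * √d / R) ^ (d + s * p) * tailMass d T p R s) * energyZero u := by
  have hR' : 0 ≤ R + T * √d := by positivity
  rw [energy_eq_truncatedEnergy hp, ← truncatedEnergy_Ioc_add_Ioi hR', mul_add,
    ENNReal.ofReal_mul hs.1.le]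
  refine add_le_add ?_ (ofReal_mul_truncatedEnergy_Ioi_le hT hp hR hs.1 u)
  gcongr
  exact truncatedEnergy_Ioc_le_of_lipschitzWith hT.le hp hR' hs.2 u hu

end Lipschitz

section Limits

theorem tendsto_tailMass {R : ℝ} (hR : 0 < R) :
    Tendsto (tailMass d T p R) (𝓝 0) (𝓝 (d * unitBallVolume d / (p * T ^ d))) := by
  have hcont : Continuous (tailMass d T p R) := by
    unfold tailMass
    exact (continuous_const.mul (continuous_const.rpow (by fun_prop) fun _ => Or.inl hR.ne'))
      |>.div_const _
  simpa [tailMass] using hcont.tendsto 0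

theorem tendsto_rpow_mul_tailMass {Λ R : ℝ} (hΛ : 0 < Λ) (hR : 0 < R) {e : ℝ → ℝ}
    (he : ContinuousAt e 0) :
    Tendsto (fun s => Λ ^ e s * tailMass d T p R s) (𝓝 0)
      (𝓝 (Λ ^ e 0 * (d * unitBallVolume d / (p * T ^ d)))) :=
  ((Real.continuousAt_const_rpow hΛ.ne').tendsto.comp he.tendsto).mul (tendsto_tailMass hR)

theorem tendsto_one_add_div_rpow_mul (c D e : ℝ) :
    Tendsto (fun R : ℝ => (1 + D / R) ^ e * c) atTop (𝓝 c) := by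
  have hbase : Tendsto (fun R : ℝ => 1 + D / R) atTop (𝓝 1) := by
    simpa using (tendsto_const_nhds.div_atTop tendsto_id).const_add (1 : ℝ)
  simpa using (hbase.rpow_const (p := e) (Or.inl one_ne_zero)).mul_const c

end Limits

end EnergyBounds

section WeakConvergence

theorem enorm_le_liminf_enorm {𝕜 E ι : Type*} [RCLike 𝕜] [SeminormedAddCommGroup E]
    [NormedSpace 𝕜 E] {l : Filter ι} [l.NeBot] {w : ι → E} {v : E}
    (h : ∀ f : StrongDual 𝕜 E, Tendsto (fun i => f (w i)) l (𝓝 (f v))) :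
    ‖v‖ₑ ≤ liminf (fun i => ‖w i‖ₑ) l := by
  obtain ⟨g, hg, hgv⟩ := exists_dual_vector'' 𝕜 v
  have hlim : Tendsto (fun i => ‖g (w i)‖ₑ) l (𝓝 ‖v‖ₑ) := by
    have hnorm : ‖g v‖ₑ = ‖v‖ₑ := by
      rw [hgv, ← ofReal_norm, RCLike.norm_ofReal, abs_norm, ofReal_norm]
    exact hnorm ▸ (h g).enorm
  rw [← hlim.liminf_eq]
  refine liminf_le_liminf (Eventually.of_forall fun i => enorm_le_iff_norm_le.2 ?_)
  exact (g.le_of_opNorm_le hg (w i)).trans_eq (one_mul _)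

theorem norm_le_toReal_mul_norm {E F : Type*} [SeminormedAddCommGroup E]
    [SeminormedAddCommGroup F] {x : E} {y : F} {c : ℝ≥0∞} (hc : c ≠ ∞) (h : ‖x‖ₑ ≤ c * ‖y‖ₑ) :
    ‖x‖ ≤ c.toReal * ‖y‖ := by
  simpa using ENNReal.toReal_mono (ENNReal.mul_ne_top hc enorm_ne_top) h

variable {d : ℕ} {T p : ℝ} [Fact (1 ≤ p)] {u : ℕ → PerLp d T p} {v : PerLp d T p}

theorem weakTendsto_iff :
    WeakTendsto u v ↔
      ∀ l : StrongDual ℝ (PerLp d T p), Tendsto (fun n => l (u n)) atTop (𝓝 (l v)) := by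
  have hind : Topology.IsInducing fun (x : WeakSpace ℝ (PerLp d T p))
      (l : StrongDual ℝ (PerLp d T p)) => l ((toWeakSpace ℝ (PerLp d T p)).symm x) := ⟨rfl⟩
  rw [WeakTendsto, hind.tendsto_nhds_iff, tendsto_pi_nhds]
  rfl

theorem weakTendsto_of_tendsto (h : Tendsto u atTop (𝓝 v)) : WeakTendsto u v :=
  weakTendsto_iff.2 fun l => (l.continuous.tendsto v).comp h

end WeakConvergence

section LpNorm

variable {α E : Type*} {m : MeasurableSpace α} {μ : Measure α} [NormedAddCommGroup E]

theorem eLpNorm_ofReal_rpow {p : ℝ} (hp : 0 < p) (f : α → E) :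
    eLpNorm f (ENNReal.ofReal p) μ ^ p = ∫⁻ x, ‖f x‖ₑ ^ p ∂μ := by
  rw [eLpNorm_eq_eLpNorm' (by simpa using hp) ENNReal.ofReal_ne_top, ENNReal.toReal_ofReal hp.le,
    lintegral_rpow_enorm_eq_rpow_eLpNorm' hp]

theorem enorm_average_le_eLpNorm [NormedSpace ℝ E] [IsFiniteMeasure μ] {f : α → E}
    (hf : AEStronglyMeasurable f μ) {r : ℝ≥0∞} (hr : 1 ≤ r) (hr' : r ≠ ∞) :
    ‖⨍ x, f x ∂μ‖ₑ ≤ (μ Set.univ)⁻¹ ^ (1 / r).toReal * eLpNorm f r μ := by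
  rcases eq_zero_or_neZero μ with rfl | _
  · simp
  calc ‖⨍ x, f x ∂μ‖ₑ ≤ eLpNorm f 1 ((μ Set.univ)⁻¹ • μ) := by
        rw [average_eq', eLpNorm_one_eq_lintegral_enorm]
        exact enorm_integral_le_lintegral_enorm f
    _ ≤ eLpNorm f r ((μ Set.univ)⁻¹ • μ) :=
        eLpNorm_le_eLpNorm_of_exponent_le hr (hf.smul_measure _)
    _ = _ := eLpNorm_smul_measure_of_ne_top hr' f _

theorem measure_univ_mul_enorm_average_rpow_le [NormedSpace ℝ E] [IsFiniteMeasure μ] {f : α → E}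
    (hf : AEStronglyMeasurable f μ) {p : ℝ} (hp : 1 ≤ p) :
    μ Set.univ * ‖⨍ x, f x ∂μ‖ₑ ^ p ≤ ∫⁻ x, ‖f x‖ₑ ^ p ∂μ := by
  have hp0 : 0 < p := zero_lt_one.trans_le hp
  rcases eq_zero_or_neZero μ with rfl | _
  · simp
  calc μ Set.univ * ‖⨍ x, f x ∂μ‖ₑ ^ p
      ≤ μ Set.univ * ((μ Set.univ)⁻¹ ^ (1 / ENNReal.ofReal p).toReal *
          eLpNorm f (ENNReal.ofReal p) μ) ^ p := by
        gcongr
        exact enorm_average_le_eLpNorm hf (by simpa using ENNReal.ofReal_le_ofReal hp)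
          ENNReal.ofReal_ne_top
    _ = μ Set.univ * (μ Set.univ)⁻¹ * ∫⁻ x, ‖f x‖ₑ ^ p ∂μ := by
        rw [ENNReal.mul_rpow_of_nonneg _ _ hp0.le, ← ENNReal.rpow_mul, eLpNorm_ofReal_rpow hp0,
          one_div, ENNReal.toReal_inv, ENNReal.toReal_ofReal hp0.le, inv_mul_cancel₀ hp0.ne',
          ENNReal.rpow_one, mul_assoc]
    _ = ∫⁻ x, ‖f x‖ₑ ^ p ∂μ := by
        rw [ENNReal.mul_inv_cancel (NeZero.ne _) (measure_ne_top μ _), one_mul]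

variable [IsFiniteMeasure μ] {f : α → E} (hf : AEStronglyMeasurable f μ) {r : ℝ≥0∞}

include hf

theorem eLpNorm_fst_prod (hr : r ≠ ∞) :
    eLpNorm (fun z : α × α => f z.1) r (μ.prod μ) =
      μ Set.univ ^ (1 / r).toReal * eLpNorm f r μ := by
  have hmap := eLpNorm_map_measure (p := r) (μ := μ.prod μ) (f := Prod.fst) (g := f)
    (by rw [Measure.map_fst_prod]; exact hf.smul_measure _) measurable_fst.aemeasurable
  rw [Measure.map_fst_prod, eLpNorm_smul_measure_of_ne_top hr, smul_eq_mul] at hmap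
  exact hmap.symm

theorem eLpNorm_snd_prod (hr : r ≠ ∞) :
    eLpNorm (fun z : α × α => f z.2) r (μ.prod μ) =
      μ Set.univ ^ (1 / r).toReal * eLpNorm f r μ := by
  have hmap := eLpNorm_map_measure (p := r) (μ := μ.prod μ) (f := Prod.snd) (g := f)
    (by rw [Measure.map_snd_prod]; exact hf.smul_measure _) measurable_snd.aemeasurable
  rw [Measure.map_snd_prod, eLpNorm_smul_measure_of_ne_top hr, smul_eq_mul] at hmap
  exact hmap.symm

theorem eLpNorm_fst_sub_snd_le (hr : 1 ≤ r) (hr' : r ≠ ∞) :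
    eLpNorm (fun z : α × α => f z.1 - f z.2) r (μ.prod μ) ≤
      2 * μ Set.univ ^ (1 / r).toReal * eLpNorm f r μ := by
  refine (eLpNorm_sub_le hf.comp_fst hf.comp_snd hr).trans_eq ?_
  rw [eLpNorm_fst_prod hf hr', eLpNorm_snd_prod hf hr']
  ring

end LpNorm

section PeriodicLp

variable {d : ℕ} {T p : ℝ}

/-- The function `(x, y) ↦ u x - u y` of `L^p(Q_T × Q_T)`, whose norm to the power `p` is
`F_p^0(u)`. -/
noncomputable def difference (u : PerLp d T p) : Lp ℝ (ENNReal.ofReal p)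
    (((volume : Measure (EuclideanSpace ℝ (Fin d))).restrict (cell d T)).prod
      (volume.restrict (cell d T))) :=
  ((u.2.2.2.comp_fst _).sub (u.2.2.2.comp_snd _)).toLp _

theorem isLinearMap_difference :
    IsLinearMap ℝ (difference : PerLp d T p → _) where
  map_add u v := by
    rw [difference, difference, difference, ← MemLp.toLp_add]
    refine MemLp.toLp_congr _ _ (Eventually.of_forall fun z => ?_)
    exact add_sub_add_comm (u z.1) (v z.1) (u z.2) (v z.2)
  map_smul c u := by
    rw [difference, difference, ← MemLp.toLp_const_smul]
    refine MemLp.toLp_congr _ _ (Eventually.of_forall fun z => ?_)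
    exact (mul_sub c (u z.1) (u z.2)).symm

theorem energyZero_eq_lintegral_enorm (hp : 0 ≤ p) (u : PerLp d T p) :
    energyZero u = ∫⁻ x in cell d T, ∫⁻ y in cell d T, ‖u x - u y‖ₑ ^ p := by
  simp only [energyZero, Real.enorm_eq_ofReal_abs,
    ENNReal.ofReal_rpow_of_nonneg (abs_nonneg _) hp]

theorem enorm_difference_rpow (hp : 0 < p) (u : PerLp d T p) :
    ‖difference u‖ₑ ^ p = energyZero u := by
  have hL := (u.2.2.2.comp_fst (volume.restrict (cell d T))).sub (u.2.2.2.comp_snd _)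
  rw [difference, Lp.enorm_toLp, eLpNorm_ofReal_rpow hp, energyZero_eq_lintegral_enorm hp.le]
  exact lintegral_prod _ (hL.1.enorm.pow_const p)

theorem energyZero_ne_top (hp : 0 < p) (u : PerLp d T p) : energyZero u ≠ ∞ := by
  rw [← enorm_difference_rpow hp]
  exact ENNReal.rpow_ne_top_of_nonneg hp.le enorm_ne_top

theorem cellAverage_eq_average (hT : 0 ≤ T) (u : PerLp d T p) :
    cellAverage u = ⨍ x in cell d T, u x := by
  rw [cellAverage, setAverage_eq, Measure.real, volume_cell d hT,
    ENNReal.toReal_ofReal (by positivity), one_div, smul_eq_mul]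

theorem cellAverage_center (hT : 0 ≤ T) (u : PerLp d T p) : cellAverage (center u) = 0 := by
  have hint : ∫ x in cell d T, (u x - cellAverage u) = 0 := by
    rw [cellAverage_eq_average hT]
    exact integral_sub_average (volume.restrict (cell d T)) u
  exact (congrArg _ hint).trans (mul_zero _)

variable [hp : Fact (1 ≤ p)]

theorem enorm_eq_eLpNorm (u : PerLp d T p) :
    ‖u‖ₑ = eLpNorm u (ENNReal.ofReal p) (volume.restrict (cell d T)) :=
  Lp.enorm_toLp u.2.2.2

theorem isBoundedLinearMap_difference :
    IsBoundedLinearMap ℝ (difference : PerLp d T p → _) := by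
  have hfin : 2 * (volume.restrict (cell d T)) Set.univ ^ (1 / ENNReal.ofReal p).toReal ≠ ∞ :=
    ENNReal.mul_ne_top ENNReal.ofNat_ne_top
      (ENNReal.rpow_ne_top_of_nonneg ENNReal.toReal_nonneg (measure_ne_top _ _))
  refine isLinearMap_difference.with_bound _ fun u => norm_le_toReal_mul_norm hfin ?_
  rw [difference, Lp.enorm_toLp, enorm_eq_eLpNorm]
  exact eLpNorm_fst_sub_snd_le u.2.2.2.1 Fact.out ENNReal.ofReal_ne_top

theorem continuous_energyZero : Continuous (energyZero : PerLp d T p → ℝ≥0∞) := by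
  have hp0 : 0 < p := zero_lt_one.trans_le hp.out
  simp only [← funext (enorm_difference_rpow hp0)]
  exact ENNReal.continuous_rpow_const.comp isBoundedLinearMap_difference.continuous.enorm

theorem energyZero_le_liminf {w : ℕ → PerLp d T p} {u : PerLp d T p} (h : WeakTendsto w u) :
    energyZero u ≤ liminf (fun n => energyZero (w n)) atTop := by
  have hp0 : 0 < p := zero_lt_one.trans_le hp.out
  have hnorm : ‖difference u‖ₑ ≤ liminf (fun n => ‖difference (w n)‖ₑ) atTop :=
    enorm_le_liminf_enorm (𝕜 := ℝ) fun f =>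
      weakTendsto_iff.1 h (f.comp isBoundedLinearMap_difference.toContinuousLinearMap)
  simp only [← enorm_difference_rpow hp0]
  calc ‖difference u‖ₑ ^ p ≤ liminf (fun n => ‖difference (w n)‖ₑ) atTop ^ p := by gcongr
    _ = liminf (fun n => ‖difference (w n)‖ₑ ^ p) atTop :=
        (ENNReal.orderIsoRpow p hp0).liminf_apply

theorem isBoundedLinearMap_cellAverage (hT : 0 < T) :
    IsBoundedLinearMap ℝ (cellAverage : PerLp d T p → ℝ) := by
  have hint : ∀ u : PerLp d T p, Integrable u (volume.restrict (cell d T)) := fun u =>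
    u.2.2.2.integrable Fact.out
  have hlin : IsLinearMap ℝ (cellAverage : PerLp d T p → ℝ) :=
    { map_add := fun u v => by
        rw [cellAverage, cellAverage, cellAverage, ← mul_add, ← integral_add (hint u) (hint v)]
        rfl
      map_smul := fun c u => by
        have hc : ∫ x in cell d T, (c • u) x = c * ∫ x in cell d T, u x := integral_const_mul c _
        rw [cellAverage, cellAverage, hc, mul_left_comm, smul_eq_mul] }
  have hfin : ((volume.restrict (cell d T)) Set.univ)⁻¹ ^ (1 / ENNReal.ofReal p).toReal ≠ ∞ := by
    rw [Measure.restrict_apply_univ]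
    exact ENNReal.rpow_ne_top_of_nonneg ENNReal.toReal_nonneg
      (ENNReal.inv_ne_top.2 (volume_cell_ne_zero hT))
  refine hlin.with_bound _ fun u => norm_le_toReal_mul_norm hfin ?_
  rw [cellAverage_eq_average hT.le, enorm_eq_eLpNorm]
  exact enorm_average_le_eLpNorm u.2.2.2.1 Fact.out ENNReal.ofReal_ne_top

theorem volume_cell_mul_enorm_center_rpow_le (hT : 0 < T) (u : PerLp d T p) :
    volume (cell d T) * ‖center u‖ₑ ^ p ≤ energyZero u := by
  have hp0 : 0 < p := zero_lt_one.trans_le hp.out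
  have hcenter : ∀ x, center u x = ⨍ y in cell d T, (u x - u y) := fun x => by
    have hV : NeZero (volume.restrict (cell d T)) :=
      ⟨Measure.restrict_eq_zero.not.2 (volume_cell_ne_zero hT)⟩
    have hu : Integrable u ((volume.restrict (cell d T) Set.univ)⁻¹ • volume.restrict (cell d T)) :=
      (u.2.2.2.integrable Fact.out).smul_measure
        (ENNReal.inv_ne_top.2 (Measure.measure_univ_ne_zero.2 hV.ne))
    rw [average, integral_sub (integrable_const _) hu, ← average, ← average, average_const,
      ← cellAverage_eq_average hT.le]
    rfl
  rw [enorm_eq_eLpNorm, eLpNorm_ofReal_rpow hp0, energyZero_eq_lintegral_enorm hp0.le,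
    ← lintegral_const_mul' _ _ (cell_volume_lt_top d T).ne]
  refine lintegral_mono fun x => ?_
  rw [hcenter, ← Measure.restrict_apply_univ (μ := volume) (cell d T)]
  exact measure_univ_mul_enorm_average_rpow_le (aestronglyMeasurable_const.sub u.2.2.2.1) hp.out

end PeriodicLp

section WeakCompactness

variable {d : ℕ} {T p : ℝ}

theorem measurable_fract {ι E : Type*} [Fintype ι] [NormedAddCommGroup E] [NormedSpace ℝ E]
    [MeasurableSpace E] [BorelSpace E] (b : Module.Basis ι ℝ E) : Measurable (ZSpan.fract b) := by
  have := Module.Finite.of_basis b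
  have := FiniteDimensional.proper_real E
  have hfract : ∀ x, ZSpan.fract b x = ∑ i, Int.fract (b.repr x i) • b i := fun x => by
    simp only [← ZSpan.repr_fract_apply, b.sum_repr]
  have hcoord : ∀ i, Measurable fun x => b.repr x i := fun i =>
    (b.coord i).continuous_of_finiteDimensional.measurable
  rw [funext hfract]
  exact Finset.measurable_sum _ fun i _ => (hcoord i).fract.smul_const (b i)

theorem surjective_restrictCell (hT : 0 < T) :
    Function.Surjective (PerLp.restrictCell d T p) := fun f => by
  set b := latticeBasis d hT
  have hae : (fun x => f (ZSpan.fract b x)) =ᵐ[volume.restrict (cell d T)] f := by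
    have hmem : ∀ᵐ x ∂volume.restrict (cell d T), x ∈ ZSpan.fundamentalDomain b := by
      rw [← Measure.restrict_congr_set (fundamentalDomain_ae_eq_cell hT)]
      exact ae_restrict_mem (ZSpan.fundamentalDomain_measurableSet b)
    filter_upwards [hmem] with x hx
    rw [ZSpan.fract_eq_self.2 hx]
  have hmeas : StronglyMeasurable fun x => f (ZSpan.fract b x) :=
    (Lp.stronglyMeasurable f).comp_measurable (measurable_fract b)
  have hL := (memLp_congr_ae hae).2 (Lp.memLp f)
  refine ⟨⟨_, hmeas.aestronglyMeasurable, fun i => Eventually.of_forall fun x => ?_, hL⟩,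
    Lp.ext (hL.coeFn_toLp.trans hae)⟩
  have hperiod : T • EuclideanSpace.single i 1 ∈ Submodule.span ℤ (Set.range b) :=
    (lattice_le_iff hT).1 le_rfl i
  simp only [ZSpan.fract_add_ZSpan b x hperiod]

variable [Fact (1 ≤ p)]

theorem exists_comp_restrictCell_eq (hT : 0 < T) (l : StrongDual ℝ (PerLp d T p)) :
    ∃ l' : StrongDual ℝ (Lp ℝ (ENNReal.ofReal p)
        ((volume : Measure (EuclideanSpace ℝ (Fin d))).restrict (cell d T))),
      ∀ u, l' (PerLp.restrictCell d T p u) = l u := by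
  let e : PerLp d T p →ₗᵢ[ℝ] Lp ℝ (ENNReal.ofReal p)
      ((volume : Measure (EuclideanSpace ℝ (Fin d))).restrict (cell d T)) :=
    ⟨PerLp.restrictCell d T p, fun _ => rfl⟩
  exact ⟨l.extend e.toContinuousLinearMap, ContinuousLinearMap.extend_eq l
    (surjective_restrictCell hT).denseRange e.isometry.isUniformInducing⟩

theorem exists_weakTendsto_subseq (hT : 0 < T) (hp : 1 < p) {u : ℕ → PerLp d T p} {C : ℝ}
    (hu : ∀ n, ‖u n‖ ≤ C) :
    ∃ φ : ℕ → ℕ, StrictMono φ ∧ ∃ v, WeakTendsto (fun k => u (φ k)) v := by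
  obtain ⟨φ, hφ, v, hv⟩ := exists_subseq_tendsto_functional hp
    (f := fun n => PerLp.restrictCell d T p (u n)) hu
  obtain ⟨v, rfl⟩ := surjective_restrictCell hT v
  refine ⟨φ, hφ, v, weakTendsto_iff.2 fun l => ?_⟩
  obtain ⟨l', hl'⟩ := exists_comp_restrictCell_eq hT l
  simpa only [hl'] using hv l'

end WeakCompactness

section Density

theorem exists_eLpNorm_thickenedIndicator_sub_indicator_le {X : Type*} [PseudoEMetricSpace X]
    [MeasurableSpace X] [OpensMeasurableSpace X] {μ : Measure X} [IsFiniteMeasure μ] {r : ℝ≥0∞}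
    (hr : r ≠ ∞) (c : ℝ) {F : Set X} (hF : IsClosed F) {ε : ℝ≥0∞} (hε : ε ≠ 0) :
    ∃ (δ : ℝ) (hδ : 0 < δ), eLpNorm
      ((fun x => c * (thickenedIndicator hδ F x : ℝ)) - F.indicator fun _ => c) r μ ≤ ε := by
  obtain ⟨η, hη0, hη⟩ := exists_eLpNorm_indicator_le (μ := μ) hr c hε
  have hη' : (η : ℝ≥0∞) ≠ 0 := by simpa using hη0.ne'
  obtain ⟨δ, hδμ, hδ : 0 < δ⟩ := ((tendsto_measure_thickening_of_isClosed (μ := μ)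
    ⟨1, zero_lt_one, measure_ne_top _ _⟩ hF).eventually (gt_mem_nhds
      (ENNReal.lt_add_right (measure_ne_top μ F) hη')) |>.and self_mem_nhdsWithin).exists
  have hS : μ (Metric.thickening δ F \ F) ≤ η := by
    rw [measure_sdiff (Metric.self_subset_thickening hδ F) hF.measurableSet.nullMeasurableSet
      (measure_ne_top _ _)]
    exact tsub_le_iff_left.2 hδμ.le
  refine ⟨δ, hδ, (eLpNorm_mono fun x => ?_).trans (hη _ hS)⟩
  simp only [Pi.sub_apply]
  by_cases hxF : x ∈ F
  · simp [hxF, thickenedIndicator_one hδ F hxF]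
  by_cases hxδ : x ∈ Metric.thickening δ F
  · have hle : (thickenedIndicator hδ F x : ℝ) ≤ 1 := mod_cast thickenedIndicator_le_one hδ F x
    simpa [hxF, hxδ] using mul_le_of_le_one_right (abs_nonneg c) hle
  · simp [hxF, hxδ, thickenedIndicator_zero hδ F hxδ]

theorem thickenedIndicator_add_addSubgroup_apply_add {X : Type*} [SeminormedAddCommGroup X]
    {δ : ℝ} (hδ : 0 < δ) (K : Set X) {H : AddSubgroup X} {g : X} (hg : g ∈ H) (x : X) :
    thickenedIndicator hδ (K + (H : Set X)) (x + g) =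
      thickenedIndicator hδ (K + (H : Set X)) x := by
  have himg : (fun y => y + g) '' (K + H : Set X) = K + H := by
    have hH : (H + {g} : Set X) = H := by
      ext y
      simp [add_mem_cancel_right (neg_mem hg)]
    rw [← Set.add_singleton, add_assoc, hH]
  have hdist := Metric.infEDist_image (isometry_add_right g) (x := x) (t := (K + H : Set X))
  rw [himg] at hdist
  simp only [thickenedIndicator_apply, thickenedIndicatorAux, hdist]

variable {d : ℕ} {T p : ℝ}

theorem isClosed_add_lattice (hT : 0 < T) {K : Set (EuclideanSpace ℝ (Fin d))} (hK : IsCompact K) :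
    IsClosed (K + (lattice d hT : Set (EuclideanSpace ℝ (Fin d)))) := by
  have : DiscreteTopology (lattice d hT) :=
    inferInstanceAs
      (DiscreteTopology (Submodule.span ℤ (Set.range (latticeBasis d hT))).toAddSubgroup)
  exact IsClosed.add_left_of_isCompact AddSubgroup.isClosed_of_discrete hK

theorem add_lattice_inter_fundamentalDomain (hT : 0 < T) {K : Set (EuclideanSpace ℝ (Fin d))}
    (hK : K ⊆ ZSpan.fundamentalDomain (latticeBasis d hT)) :
    (K + (lattice d hT : Set (EuclideanSpace ℝ (Fin d)))) ∩
      ZSpan.fundamentalDomain (latticeBasis d hT) = K := by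
  refine Set.Subset.antisymm ?_ fun x hx =>
    ⟨Set.mem_add.2 ⟨x, hx, 0, zero_mem _, add_zero x⟩, hK hx⟩
  rintro _ ⟨⟨k, hk, g, hg, rfl⟩, hx⟩
  have hfract := ZSpan.fract_add_ZSpan (latticeBasis d hT) k hg
  rw [ZSpan.fract_eq_self.2 hx, ZSpan.fract_eq_self.2 (hK hk)] at hfract
  rwa [hfract]

theorem exists_isCompact_measure_symmDiff_add_lattice_le (hT : 0 < T)
    {A : Set (EuclideanSpace ℝ (Fin d))} (hA : MeasurableSet A) {η : ℝ≥0∞} (hη : η ≠ 0) :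
    ∃ K : Set (EuclideanSpace ℝ (Fin d)), IsCompact K ∧
      volume.restrict (cell d T) (symmDiff (K + (lattice d hT : Set _)) A) ≤ η := by
  set D := ZSpan.fundamentalDomain (latticeBasis d hT)
  have hD : MeasurableSet D := ZSpan.fundamentalDomain_measurableSet _
  rw [← Measure.restrict_congr_set (fundamentalDomain_ae_eq_cell hT)]
  have hfin : volume D ≠ ∞ := by
    rw [measure_congr (fundamentalDomain_ae_eq_cell hT)]
    exact (cell_volume_lt_top d T).ne
  obtain ⟨K, hKA, hK, -, hμK⟩ := (hA.inter hD).exists_isCompact_isClosed_sdiff_lt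
    (ne_top_of_le_ne_top hfin (measure_mono Set.inter_subset_right)) hη
  have hKD := add_lattice_inter_fundamentalDomain hT (hKA.trans Set.inter_subset_right)
  refine ⟨K, hK, le_trans ?_ hμK.le⟩
  rw [Measure.restrict_apply' hD, Set.inter_symmDiff_distrib_right, hKD,
    symmDiff_of_le hKA]

theorem exists_lipschitzWith_eq_mul_thickenedIndicator (hT : 0 < T) (c : ℝ) {δ : ℝ} (hδ : 0 < δ)
    (K : Set (EuclideanSpace ℝ (Fin d))) :
    ∃ v : PerLp d T p, (∃ L, LipschitzWith L v) ∧
      v.1 = fun x => c * (thickenedIndicator hδ (K + (lattice d hT : Set _)) x : ℝ) := by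
  set F := K + (lattice d hT : Set (EuclideanSpace ℝ (Fin d)))
  have hlip : LipschitzWith (‖c‖₊ * δ.toNNReal⁻¹) fun x => c * (thickenedIndicator hδ F x : ℝ) :=
    (lipschitzWith_smul c).comp
      (LipschitzWith.of_dist_le_mul (lipschitzWith_thickenedIndicator hδ F).dist_le_mul)
  have hbound : ∀ x, ‖c * (thickenedIndicator hδ F x : ℝ)‖ ≤ ‖c‖ := fun x => by
    have hle : (thickenedIndicator hδ F x : ℝ) ≤ 1 := mod_cast thickenedIndicator_le_one hδ F x
    simpa using mul_le_of_le_one_right (abs_nonneg c) hle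
  refine ⟨⟨_, hlip.continuous.aestronglyMeasurable, fun i => Eventually.of_forall fun x => ?_,
    .of_bound hlip.continuous.aestronglyMeasurable _ (Eventually.of_forall hbound)⟩,
    ⟨_, hlip⟩, rfl⟩
  have hperiod := (lattice_le_iff hT).1 le_rfl i
  simp only [F, thickenedIndicator_add_addSubgroup_apply_add hδ K hperiod]

theorem exists_lipschitzWith_eLpNorm_sub_indicator_le (hT : 0 < T) [Fact (1 ≤ p)] (c : ℝ)
    {A : Set (EuclideanSpace ℝ (Fin d))} (hA : MeasurableSet A) {ε : ℝ≥0∞} (hε : ε ≠ 0) :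
    ∃ v : PerLp d T p, (∃ L, LipschitzWith L v) ∧
      eLpNorm (v.1 - A.indicator fun _ => c) (ENNReal.ofReal p) (volume.restrict (cell d T)) ≤
        ε := by
  set μ := (volume : Measure (EuclideanSpace ℝ (Fin d))).restrict (cell d T)
  have hp : ENNReal.ofReal p ≠ ∞ := ENNReal.ofReal_ne_top
  have hε2 : ε / 2 ≠ 0 := by simpa using hε
  obtain ⟨η, hη0, hη⟩ := exists_eLpNorm_indicator_le (μ := μ) hp c hε2
  obtain ⟨K, hK, hKA⟩ := exists_isCompact_measure_symmDiff_add_lattice_le hT hA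
    (ENNReal.coe_ne_zero.2 hη0.ne')
  have hF := isClosed_add_lattice hT hK
  set F := K + (lattice d hT : Set (EuclideanSpace ℝ (Fin d)))
  obtain ⟨δ, hδ, hδF⟩ := exists_eLpNorm_thickenedIndicator_sub_indicator_le (μ := μ) hp c hF hε2
  obtain ⟨v, hv, hvδ⟩ := exists_lipschitzWith_eq_mul_thickenedIndicator (p := p) hT c hδ K
  have hFc : AEStronglyMeasurable (F.indicator fun _ => c) μ :=
    aestronglyMeasurable_const.indicator hF.measurableSet
  have hAc : AEStronglyMeasurable (A.indicator fun _ => c) μ :=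
    aestronglyMeasurable_const.indicator hA
  refine ⟨v, hv, ?_⟩
  calc eLpNorm (v.1 - A.indicator fun _ => c) (ENNReal.ofReal p) μ
      ≤ eLpNorm (v.1 - F.indicator fun _ => c) (ENNReal.ofReal p) μ +
          eLpNorm ((F.indicator fun _ => c) - A.indicator fun _ => c) (ENNReal.ofReal p) μ := by
        rw [← sub_add_sub_cancel v.1 (F.indicator fun _ => c)]
        exact eLpNorm_add_le (v.2.2.2.1.sub hFc) (hFc.sub hAc) Fact.out
    _ ≤ ε / 2 + ε / 2 := by
        rw [hvδ, eLpNorm_indicator_sub_indicator]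
        exact add_le_add hδF (hη _ hKA)
    _ = ε := ENNReal.add_halves ε

theorem exists_lipschitzWith_norm_sub_le (hT : 0 < T) [Fact (1 ≤ p)] (u : PerLp d T p) {ε : ℝ}
    (hε : 0 < ε) : ∃ v : PerLp d T p, ‖u - v‖ ≤ ε ∧ ∃ K, LipschitzWith K v := by
  obtain ⟨_, hg, ⟨v, rfl, hv⟩⟩ := u.2.2.2.induction_dense ENNReal.ofReal_ne_top
    (fun g => ∃ v : PerLp d T p, (v : EuclideanSpace ℝ (Fin d) → ℝ) = g ∧ ∃ K, LipschitzWith K v)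
    (fun c A hA _ ε hε =>
      let ⟨v, hv, hvA⟩ := exists_lipschitzWith_eLpNorm_sub_indicator_le hT c hA hε
      ⟨v, hvA, v, rfl, hv⟩)
    (by
      rintro _ _ ⟨v, rfl, K, hK⟩ ⟨w, rfl, L, hL⟩
      exact ⟨v + w, rfl, K + L, hK.add hL⟩)
    (by
      rintro _ ⟨v, rfl, -⟩
      exact v.2.1.mono_ac Measure.restrict_le_self.absolutelyContinuous)
    (ENNReal.ofReal_pos.2 hε).ne'
  refine ⟨v, ?_, hv⟩
  rw [← ENNReal.ofReal_le_ofReal_iff hε.le, ofReal_norm, enorm_eq_eLpNorm]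
  exact hg

end Density

section GammaConvergence

theorem exists_tendsto_atTop_eventually {P : ℕ → ℕ → Prop} (h : ∀ j, ∀ᶠ n in atTop, P j n) :
    ∃ k : ℕ → ℕ, Tendsto k atTop atTop ∧ ∀ᶠ n in atTop, P (k n) n := by
  choose N hN using fun j => eventually_atTop.1 (h j)
  refine ⟨fun n => Nat.findGreatest (fun j => N j ≤ n) n, tendsto_atTop.2 fun j => ?_, ?_⟩
  · filter_upwards [eventually_ge_atTop (max j (N j))] with n hn
    exact Nat.le_findGreatest ((le_max_left _ _).trans hn) ((le_max_right _ _).trans hn)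
  · filter_upwards [eventually_ge_atTop (N 0)] with n hn
    exact hN _ _ (Nat.findGreatest_spec (P := fun j => N j ≤ n) n.zero_le hn)

variable {d : ℕ} {T p : ℝ}

theorem tendsto_rpow_neg_mul_tailMass (hT : 0 ≤ T) {R : ℝ} (hR : 0 < R) :
    Tendsto (fun t => (1 + T * √d / R) ^ (-(d + t * p)) * tailMass d T p (R + T * √d) t) (𝓝 0)
      (𝓝 ((1 + T * √d / R) ^ (-(d : ℝ)) * (d * unitBallVolume d / (p * T ^ d)))) := by
  simpa using tendsto_rpow_mul_tailMass (d := d) (T := T) (p := p) (R := R + T * √d)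
    (e := fun t => -(d + t * p)) (by positivity) (by positivity) (by fun_prop)

theorem tendsto_rpow_mul_one_sub_div {R : ℝ} (hp : p ≠ 0) (hR : R ≠ 0) :
    Tendsto (fun t : ℝ => R ^ (p * (1 - t)) / (p * (1 - t))) (𝓝 0) (𝓝 (R ^ p / p)) := by
  have hexp : Tendsto (fun t : ℝ => p * (1 - t)) (𝓝 0) (𝓝 p) :=
    Continuous.tendsto' (by fun_prop) _ _ (by ring)
  exact (((Real.continuous_const_rpow hR).tendsto p).comp hexp).div hexp hp

variable [NeZero d] [hp : Fact (1 ≤ p)] {s : ℕ → ℝ}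

theorem mul_energyZero_le_liminf (hT : 0 < T) (hs : Tendsto s atTop (𝓝[>] 0)) {u : PerLp d T p}
    {w : ℕ → PerLp d T p} (hw : WeakTendsto w u) :
    ENNReal.ofReal (d * unitBallVolume d / (p * T ^ d)) * energyZero u ≤
      liminf (fun n => ENNReal.ofReal (s n) * energy (s n) (w n)) atTop := by
  have hp0 : 0 < p := zero_lt_one.trans_le hp.out
  have hbound : ∀ R : ℝ, 0 < R →
      ENNReal.ofReal ((1 + T * √d / R) ^ (-(d : ℝ)) * (d * unitBallVolume d / (p * T ^ d))) *
        energyZero u ≤ liminf (fun n => ENNReal.ofReal (s n) * energy (s n) (w n)) atTop := by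
    intro R hR
    have hcoeff := (ENNReal.tendsto_ofReal (tendsto_rpow_neg_mul_tailMass (d := d) (p := p)
      hT.le hR)).comp (hs.mono_right nhdsWithin_le_nhds)
    refine (mul_le_mul' hcoeff.liminf_eq.ge (energyZero_le_liminf hw)).trans
      (ENNReal.le_liminf_mul.trans (liminf_le_liminf ?_))
    filter_upwards [hs self_mem_nhdsWithin] with n hn
    exact ofReal_mul_energyZero_le hT hp0 hR hn (w n)
  have hlim := ENNReal.Tendsto.mul_const (ENNReal.tendsto_ofReal
    (tendsto_one_add_div_rpow_mul (d * unitBallVolume d / (p * T ^ d)) (T * √d) (-(d : ℝ))))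
    (Or.inr (energyZero_ne_top hp0 u))
  exact le_of_tendsto hlim ((eventually_gt_atTop 0).mono hbound)

theorem limsup_energy_le_of_lipschitzWith (hT : 0 < T) (hs : Tendsto s atTop (𝓝[>] 0))
    {u : PerLp d T p} {K : ℝ≥0} (hu : LipschitzWith K u) :
    limsup (fun n => ENNReal.ofReal (s n) * energy (s n) u) atTop ≤
      ENNReal.ofReal (d * unitBallVolume d / (p * T ^ d)) * energyZero u := by
  have hp0 : 0 < p := zero_lt_one.trans_le hp.out
  have hbound : ∀ R : ℝ, 0 < R →
      limsup (fun n => ENNReal.ofReal (s n) * energy (s n) u) atTop ≤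
        ENNReal.ofReal ((1 + T * √d / R) ^ (d : ℝ) * (d * unitBallVolume d / (p * T ^ d))) *
          energyZero u := by
    intro R hR
    have htail : Tendsto (fun t => (1 + T * √d / R) ^ (d + t * p) * tailMass d T p R t) (𝓝 0)
        (𝓝 ((1 + T * √d / R) ^ (d : ℝ) * (d * unitBallVolume d / (p * T ^ d)))) := by
      simpa using tendsto_rpow_mul_tailMass (d := d) (T := T) (p := p)
        (e := fun t => d + t * p) (by positivity) hR (by fun_prop)
    have hnear : Tendsto (fun t : ℝ => t * (K ^ p * (d * unitBallVolume d *
        ((R + T * √d) ^ (p * (1 - t)) / (p * (1 - t)))) * T ^ d)) (𝓝 0) (𝓝 0) := by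
      simpa using tendsto_id.mul (((tendsto_rpow_mul_one_sub_div hp0.ne'
        (R := R + T * √d) (by positivity)).const_mul (d * unitBallVolume d)).const_mul
          ((K : ℝ) ^ p) |>.mul_const (T ^ d))
    have hupper := (((ENNReal.tendsto_ofReal hnear).add (ENNReal.Tendsto.mul_const
      (ENNReal.tendsto_ofReal htail) (Or.inr (energyZero_ne_top hp0 u))))).comp
        (hs.mono_right nhdsWithin_le_nhds)
    rw [ENNReal.ofReal_zero, zero_add] at hupper
    rw [← hupper.limsup_eq]
    refine limsup_le_limsup ?_
    filter_upwards [hs (Ioo_mem_nhdsGT zero_lt_one)] with n hn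
    exact ofReal_mul_energy_le_of_lipschitzWith hT hp0 hR hn u hu
  have hlim := ENNReal.Tendsto.mul_const (ENNReal.tendsto_ofReal
    (tendsto_one_add_div_rpow_mul (d * unitBallVolume d / (p * T ^ d)) (T * √d) d))
    (Or.inr (energyZero_ne_top hp0 u))
  exact ge_of_tendsto hlim ((eventually_gt_atTop 0).mono hbound)

theorem exists_recovery_sequence (hT : 0 < T) (hs : Tendsto s atTop (𝓝[>] 0)) (u : PerLp d T p) :
    ∃ w : ℕ → PerLp d T p, WeakTendsto w u ∧
      limsup (fun n => ENNReal.ofReal (s n) * energy (s n) (w n)) atTop ≤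
        ENNReal.ofReal (d * unitBallVolume d / (p * T ^ d)) * energyZero u := by
  have hp0 : 0 < p := zero_lt_one.trans_le hp.out
  set c := ENNReal.ofReal (d * unitBallVolume d / (p * T ^ d))
  choose v hv K hK using fun j : ℕ =>
    exists_lipschitzWith_norm_sub_le hT u (Nat.one_div_pos_of_nat (α := ℝ) (n := j))
  have hvu : Tendsto v atTop (𝓝 u) := by
    rw [tendsto_iff_norm_sub_tendsto_zero]
    exact squeeze_zero (fun _ => norm_nonneg _) (fun j => (norm_sub_rev _ _).trans_le (hv j))
      tendsto_one_div_add_atTop_nhds_zero_nat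
  set b : ℕ → ℝ≥0∞ := fun j => c * energyZero (v j) + ENNReal.ofReal (1 / ((j : ℝ) + 1))
  have hb : Tendsto b atTop (𝓝 (c * energyZero u)) := by
    simpa [b] using (ENNReal.Tendsto.const_mul (a := c) ((continuous_energyZero.tendsto u).comp hvu)
      (Or.inr ENNReal.ofReal_ne_top)).add
        (ENNReal.tendsto_ofReal (tendsto_one_div_add_atTop_nhds_zero_nat (𝕜 := ℝ)))
  have hvb : ∀ j, ∀ᶠ n in atTop, ENNReal.ofReal (s n) * energy (s n) (v j) ≤ b j := fun j => by
    have hlt : c * energyZero (v j) < b j :=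
      ENNReal.lt_add_right (ENNReal.mul_ne_top ENNReal.ofReal_ne_top (energyZero_ne_top hp0 _))
        (ENNReal.ofReal_pos.2 Nat.one_div_pos_of_nat).ne'
    exact (eventually_lt_of_limsup_lt
      ((limsup_energy_le_of_lipschitzWith hT hs (hK j)).trans_lt hlt)).mono fun _ => le_of_lt
  obtain ⟨k, hk, hkb⟩ := exists_tendsto_atTop_eventually hvb
  refine ⟨fun n => v (k n), weakTendsto_of_tendsto (hvu.comp hk), ?_⟩
  rw [← (hb.comp hk).limsup_eq]
  exact limsup_le_limsup hkb

theorem exists_mul_energyZero_le (hT : 0 < T) :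
    ∃ κ : ℝ, 0 < κ ∧ ∀ᶠ t in 𝓝[>] 0, ∀ u : PerLp d T p,
      ENNReal.ofReal κ * energyZero u ≤ ENNReal.ofReal t * energy t u := by
  have hp0 : 0 < p := zero_lt_one.trans_le hp.out
  have hd : (0 : ℝ) < d := mod_cast NeZero.pos d
  have hω := unitBallVolume_pos d
  set κ := (1 + T * √d / 1) ^ (-(d : ℝ)) * (d * unitBallVolume d / (p * T ^ d))
  have hκ : 0 < κ := by positivity
  refine ⟨κ / 2, half_pos hκ, ?_⟩
  filter_upwards [nhdsWithin_le_nhds ((tendsto_rpow_neg_mul_tailMass hT.le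
    zero_lt_one).eventually_const_lt (half_lt_self hκ)), self_mem_nhdsWithin] with t ht ht0 u
  exact (mul_le_mul_left (ENNReal.ofReal_le_ofReal ht.le) _).trans
    (ofReal_mul_energyZero_le hT hp0 zero_lt_one ht0 u)

theorem exists_norm_center_le (hT : 0 < T) {C : ℝ≥0∞} (hC : C ≠ ∞) :
    ∃ B : ℝ, ∀ᶠ t in 𝓝[>] 0, ∀ u : PerLp d T p,
      ENNReal.ofReal t * energy t u ≤ C → ‖center u‖ ≤ B := by
  have hp0 : 0 < p := zero_lt_one.trans_le hp.out
  obtain ⟨κ, hκ, hκu⟩ := exists_mul_energyZero_le (d := d) (p := p) hT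
  set q := ENNReal.ofReal κ * volume (cell d T)
  have hq : q ≠ 0 := mul_ne_zero (ENNReal.ofReal_pos.2 hκ).ne' (volume_cell_ne_zero hT)
  have hq' : q ≠ ∞ := ENNReal.mul_ne_top ENNReal.ofReal_ne_top (cell_volume_lt_top d T).ne
  have hB : (C / q) ^ p⁻¹ ≠ ∞ :=
    ENNReal.rpow_ne_top_of_nonneg (by positivity) (ENNReal.div_ne_top hC hq)
  refine ⟨((C / q) ^ p⁻¹).toReal, hκu.mono fun t ht u hu => ?_⟩
  rw [← toReal_enorm]
  refine ENNReal.toReal_mono hB ?_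
  rw [ENNReal.le_rpow_inv_iff hp0, ENNReal.le_div_iff_mul_le (Or.inl hq) (Or.inl hq'), mul_comm]
  calc q * ‖center u‖ₑ ^ p ≤ ENNReal.ofReal κ * energyZero u := by
        rw [mul_assoc]
        exact mul_le_mul_right (volume_cell_mul_enorm_center_rpow_le hT u) _
    _ ≤ C := (ht u).trans hu

theorem exists_weakTendsto_center (hT : 0 < T) (hp : 1 < p) (hs : Tendsto s atTop (𝓝[>] 0))
    {u : ℕ → PerLp d T p} {C : ℝ≥0∞} (hC : C ≠ ∞)
    (hu : ∀ n, ENNReal.ofReal (s n) * energy (s n) (u n) ≤ C) :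
    ∃ φ : ℕ → ℕ, StrictMono φ ∧ ∃ v : PerLp d T p,
      WeakTendsto (fun k => center (u (φ k))) v ∧ cellAverage v = 0 := by
  obtain ⟨B, hB⟩ := exists_norm_center_le (d := d) (p := p) hT hC
  obtain ⟨N, hN⟩ := eventually_atTop.1 (hs.eventually hB)
  obtain ⟨φ, hφ, v, hv⟩ := exists_weakTendsto_subseq hT hp (u := fun n => center (u (n + N)))
    fun n => hN _ (Nat.le_add_left N n) _ (hu _)
  refine ⟨fun k => φ k + N, fun i j hij => Nat.add_lt_add_right (hφ hij) N, v, hv, ?_⟩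
  have hlim := weakTendsto_iff.1 hv (isBoundedLinearMap_cellAverage hT).toContinuousLinearMap
  exact tendsto_nhds_unique hlim
    (tendsto_const_nhds.congr fun k => (cellAverage_center hT.le (u (φ k + N))).symm)

end GammaConvergence

end PeriodicGagliardo

theorem mainTheorem1 (d : ℕ) (hd : 1 ≤ d) (T : ℝ) (hT : 0 < T) (p : ℝ) [Fact (1 ≤ p)]
    (s : ℕ → ℝ) (hs : ∀ n, s n ∈ Set.Ioo (0 : ℝ) 1) (hs0 : Tendsto s atTop (𝓝 0)) :
    -- Compactness
    (p ≠ 1 → ∀ u : ℕ → PeriodicGagliardo.PerLp d T p, ∀ C : ℝ,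
      (⨆ n, ENNReal.ofReal (s n) * PeriodicGagliardo.energy (s n) (u n)) ≤ ENNReal.ofReal C →
      ∃ φ : ℕ → ℕ, StrictMono φ ∧ ∃ v : PeriodicGagliardo.PerLp d T p,
        PeriodicGagliardo.WeakTendsto (fun k => PeriodicGagliardo.center (u (φ k))) v ∧
        PeriodicGagliardo.cellAverage v = 0) ∧
    -- Lower bound
    (∀ (u : PeriodicGagliardo.PerLp d T p) (w : ℕ → PeriodicGagliardo.PerLp d T p),
      PeriodicGagliardo.WeakTendsto w u →
      ENNReal.ofReal (d * PeriodicGagliardo.unitBallVolume d / (p * T ^ d)) *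
          PeriodicGagliardo.energyZero u ≤
        liminf (fun n => ENNReal.ofReal (s n) * PeriodicGagliardo.energy (s n) (w n)) atTop) ∧
    -- Upper bound
    (∀ u : PeriodicGagliardo.PerLp d T p, ∃ w : ℕ → PeriodicGagliardo.PerLp d T p,
      PeriodicGagliardo.WeakTendsto w u ∧
      limsup (fun n => ENNReal.ofReal (s n) * PeriodicGagliardo.energy (s n) (w n)) atTop ≤
        ENNReal.ofReal (d * PeriodicGagliardo.unitBallVolume d / (p * T ^ d)) *
          PeriodicGagliardo.energyZero u) := by
  have : NeZero d := ⟨by omega⟩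
  have hs' : Tendsto s atTop (𝓝[>] 0) :=
    tendsto_nhdsWithin_iff.2 ⟨hs0, Eventually.of_forall fun n => (hs n).1⟩
  refine ⟨fun hp u C hC => ?_, fun u w hw => ?_, fun u => ?_⟩
  · exact PeriodicGagliardo.exists_weakTendsto_center hT (lt_of_le_of_ne Fact.out hp.symm) hs'
      ENNReal.ofReal_ne_top (iSup_le_iff.1 hC)
  · exact PeriodicGagliardo.mul_energyZero_le_liminf hT hs' hw
  · exact PeriodicGagliardo.exists_recovery_sequence hT hs' u
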